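/- Let $\Bbbk$ be a field of characteristic zero, $A$ an associative unital $\Bbbk$-algebra, and $\otimes=\otimes_{\Bbbk}$. For $d=d'\otimes d''\in A\otimes A$ (sums omitted) the outer bimodule structure on $A\otimes A$ is $b\,d\,c=bd'\otimes d''c$, and $d^\circ=d''\otimes d'$. Let $(e_s)_{s\in I}$ be a finite complete family of orthogonal idempotents of $A$ ($e_se_t=\delta_{st}e_s$, $\sum_s e_s=1$), let $B$ be their linear span, and fix two distinct elements of $I$, denoted $1$ and $2$. **Definitions.** A $B$-linear *double bracket* on $A$ is a $\Bbbk$-bilinear map $\{\!\{-,-\}\!\}:A\times A\to A\otimes A$ that vanishes as soon as one argument lies in $B$ and satisfies $\{\!\{a,b\}\!\}=-\{\!\{b,a\}\!\}^\circ$ and $\{\!\{a,bc\}\!\}=\{\!\{a,b\}\!\}c+b\{\!\{a,c\}\!\}$. Put $\tau(a_1\otimes a_2\otimes a_3)=a_3\otimes a_1\otimes a_2$ and $$\{\!\{a,b,c\}\!\}=\{\!\{a,\{\!\{b,c\}\!\}'\}\!\}\otimes\{\!\{b,c\}\!\}''+\tau\big(\{\!\{b,\{\!\{c,a\}\!\}'\}\!\}\otimes\{\!\{c,a\}\!\}''\big)+\tau^2\big(\{\!\{c,\{\!\{a,b\}\!\}'\}\!\}\otimes\{\!\{a,b\}\!\}''\big).$$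 The double bracket is *quasi-Poisson* if for all $a,b,c\in A$ $$\begin{aligned}\{\!\{a,b,c\}\!\}=\tfrac14\sum_{s\in I}\big(&ce_sa\otimes e_sb\otimes e_s-ce_sa\otimes e_s\otimes be_s-ce_s\otimes ae_sb\otimes e_s+ce_s\otimes ae_s\otimes be_s\\&-e_sa\otimes e_sb\otimes e_sc+e_sa\otimes e_s\otimes be_sc+e_s\otimes ae_sb\otimes e_sc-e_s\otimes ae_s\otimes be_sc\big).\end{aligned}$$ $(A,\{\!\{-,-\}\!\},\Phi)$ is a *quasi-Hamiltonian algebra* over $B$ if $\{\!\{-,-\}\!\}$ is a $B$-linear quasi-Poisson double bracket and $\Phi=\sum_s\Phi_s$, with $\Phi_s\in e_sAe_s$, is a *multiplicative moment map*, that is, an invertible element such that for all $s\in I$, $a\in A$ $$\{\!\{\Phi_s,a\}\!\}=\tfrac12\big(ae_s\otimes\Phi_s-e_s\otimes\Phi_sa+a\Phi_s\otimes e_s-\Phi_s\otimes e_sa\big).$$ **Fusion.** Let $\mu=1-e_1-e_2$, let $\mathrm{Mat}_2(\Bbbk)$ have matrix units $e_{11}=e_1,\,e_{12},\,e_{21},\,e_{22}=e_2$,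 and set $\bar A=A*_{\Bbbk e_1\oplus\Bbbk e_2\oplus\Bbbk\mu}(\mathrm{Mat}_2(\Bbbk)\oplus\Bbbk\mu)$ (amalgamated free product), $\epsilon=1-e_2$. The fusion algebra is $A^f=\epsilon\bar A\epsilon$, with unit $\epsilon$ and idempotents $e_s$, $s\ne2$, spanning $B^f$. Put $\mathrm{Tr}(a)=\epsilon a\epsilon+\epsilon e_{12}ae_{21}\epsilon\in A^f$ for $a\in A$. A derivation $\delta:A\to A\otimes A$ (for the outer bimodule structure) vanishing on $B$ extends uniquely to a derivation $\bar A\to\bar A\otimes\bar A$ vanishing on $\mathrm{Mat}_2(\Bbbk)\oplus\Bbbk\mu$, again denoted $\delta$, and gives $\mathrm{Tr}(\delta):A^f\to A^f\otimes A^f$, $\mathrm{Tr}(\delta)(a)=\delta(a)'\epsilon\otimes\epsilon\delta(a)''+\delta(a)'e_{21}\epsilon\otimes\epsilon e_{12}\delta(a)''$. Let $E_s(a)=ae_s\otimes e_s-e_s\otimes e_sa$. A $B$-linear double bracket on $A$ extends uniquely to a double bracket on $\bar A$ that vanishes as soon as one argument lies in $\mathrm{Mat}_2(\Bbbk)\oplus\Bbbk\mu$;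 its restriction to $A^f$, followed by $x\otimes y\mapsto\epsilon x\epsilon\otimes\epsilon y\epsilon$, is the induced bracket $\{\!\{-,-\}\!\}_{ind}$ on $A^f$. Finally set $\{\!\{-,-\}\!\}^f=\{\!\{-,-\}\!\}_{ind}+\{\!\{-,-\}\!\}_{fus}$ with $$\{\!\{b,c\}\!\}_{fus}=-\tfrac12\big(\delta_2(c)'\delta_1(b)''\otimes\delta_1(b)'\delta_2(c)''-\delta_1(c)'\delta_2(b)''\otimes\delta_2(b)'\delta_1(c)''\big),\qquad\delta_i=\mathrm{Tr}(E_i).$$ **Theorem.** If $(A,\{\!\{-,-\}\!\},\Phi)$ is a quasi-Hamiltonian algebra over $B$, then $(A^f,\{\!\{-,-\}\!\}^f,\Phi^f)$ is a quasi-Hamiltonian algebra over $B^f$, where $$\Phi^f=e_1\mathrm{Tr}(\Phi_1)\mathrm{Tr}(\Phi_2)e_1+\sum_{s\neq1,2}e_s\mathrm{Tr}(\Phi_s)e_s.$$ Moreover, $A^f$ is a finitely generated algebra if $A$ is. (The double bracket is not assumed to be differential.) -/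

import Mathlib

open scoped TensorProduct

namespace DoubleBracket

noncomputable section

/-! ### Double derivations, double brackets, quasi-Poisson and quasi-Hamiltonian algebras

The algebra structure of `A ⊗ A` is used to write the two bimodule structures: the outer one is
`b · d · c = (b ⊗ 1) * d * (1 ⊗ c)`, i.e. `b d' ⊗ d'' c`, and the inner one is
`b ∗ d ∗ c = (1 ⊗ b) * d * (c ⊗ 1)`, i.e. `d' c ⊗ b d''`. -/

section Basic

variable {k : Type*} [Field k] {A : Type*} [Ring A] [Algebra k A]

/-- A `B`-linear double derivation: a derivation `A → A ⊗ A` for the outer bimodule structure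
that vanishes on `B`. -/
structure IsDoubleDerivation (B : Subalgebra k A) (δ : A →ₗ[k] A ⊗[k] A) : Prop where
  leibniz : ∀ a b : A, δ (a * b) = (a ⊗ₜ[k] 1) * δ b + δ a * (1 ⊗ₜ[k] b)
  vanish : ∀ b ∈ B, δ b = 0

/-- A `B`-linear double bracket on `A`. -/
structure IsDoubleBracket (B : Subalgebra k A) (br : A →ₗ[k] A →ₗ[k] A ⊗[k] A) : Prop where
  antisymm : ∀ a b : A, br a b = -TensorProduct.comm k A A (br b a)
  leibniz : ∀ a b c : A, br a (b * c) = br a b * (1 ⊗ₜ[k] c) + (b ⊗ₜ[k] 1) * br a c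
  vanish_left : ∀ b ∈ B, ∀ a : A, br b a = 0
  vanish_right : ∀ b ∈ B, ∀ a : A, br a b = 0

variable (k A) in
/-- `a₁ ⊗ a₂ ⊗ a₃ ↦ a₃ ⊗ a₁ ⊗ a₂`. -/
def tau : (A ⊗[k] A) ⊗[k] A →ₗ[k] (A ⊗[k] A) ⊗[k] A :=
  (TensorProduct.assoc k A A A).symm.toLinearMap ∘ₗ
    (TensorProduct.comm k (A ⊗[k] A) A).toLinearMap

/-- `⦃a, d'⦄ ⊗ d''` for `d = d' ⊗ d''`. -/
def brLeft (br : A →ₗ[k] A →ₗ[k] A ⊗[k] A) (a : A) : A ⊗[k] A →ₗ[k] (A ⊗[k] A) ⊗[k] A :=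
  LinearMap.rTensor A (br a)

/-- The triple bracket associated to a double bracket. -/
def tripleBracket (br : A →ₗ[k] A →ₗ[k] A ⊗[k] A) (a b c : A) : (A ⊗[k] A) ⊗[k] A :=
  brLeft br a (br b c) + tau k A (brLeft br b (br c a)) + tau k A (tau k A (brLeft br c (br a b)))

/-- The subalgebra `B = ⊕ k e_s` of `A`, for a complete family of orthogonal idempotents. -/
def idemSubalgebra (k : Type*) [Field k] {A : Type*} [Ring A] [Algebra k A] {I : Type*}
    (e : I → A) : Subalgebra k A :=
  Algebra.adjoin k (Set.range e)

/-- The quasi-Poisson condition on the triple bracket. -/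
def IsQuasiPoisson {I : Type*} [Fintype I] (e : I → A) (br : A →ₗ[k] A →ₗ[k] A ⊗[k] A) : Prop :=
  ∀ a b c : A, tripleBracket br a b c = (1 / 4 : k) • ∑ s, (
      (c * e s * a) ⊗ₜ[k] (e s * b) ⊗ₜ[k] (e s)
    - (c * e s * a) ⊗ₜ[k] (e s) ⊗ₜ[k] (b * e s)
    - (c * e s) ⊗ₜ[k] (a * e s * b) ⊗ₜ[k] (e s)
    + (c * e s) ⊗ₜ[k] (a * e s) ⊗ₜ[k] (b * e s)
    - (e s * a) ⊗ₜ[k] (e s * b) ⊗ₜ[k] (e s * c)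
    + (e s * a) ⊗ₜ[k] (e s) ⊗ₜ[k] (b * e s * c)
    + (e s) ⊗ₜ[k] (a * e s * b) ⊗ₜ[k] (e s * c)
    - (e s) ⊗ₜ[k] (a * e s) ⊗ₜ[k] (b * e s * c))

/-- `Φ` is a multiplicative moment map: an invertible element of `⊕ e_s A e_s` whose components
`Φ_s = e_s Φ e_s` satisfy the moment map identity. -/
structure IsMomentMap {I : Type*} [Fintype I] (e : I → A) (br : A →ₗ[k] A →ₗ[k] A ⊗[k] A)
    (Φ : A) : Prop where
  isUnit : IsUnit Φ
  diagonal : Φ = ∑ s, e s * Φ * e s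
  moment : ∀ (s : I) (a : A), br (e s * Φ * e s) a = (1 / 2 : k) • (
      (a * e s) ⊗ₜ[k] (e s * Φ * e s)
    - (e s) ⊗ₜ[k] (e s * Φ * e s * a)
    + (a * (e s * Φ * e s)) ⊗ₜ[k] (e s)
    - (e s * Φ * e s) ⊗ₜ[k] (e s * a))

/-- `(A, br)` is a double quasi-Poisson algebra over `B = ⊕ k e_s`. -/
structure IsDoubleQuasiPoisson {I : Type*} [Fintype I] (e : I → A)
    (br : A →ₗ[k] A →ₗ[k] A ⊗[k] A) : Prop where
  idem : CompleteOrthogonalIdempotents e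
  bracket : IsDoubleBracket (idemSubalgebra k e) br
  quasiPoisson : IsQuasiPoisson e br

/-- `(A, br, Φ)` is a quasi-Hamiltonian algebra over `B = ⊕ k e_s`. -/
structure IsQuasiHamiltonian {I : Type*} [Fintype I] (e : I → A)
    (br : A →ₗ[k] A →ₗ[k] A ⊗[k] A) (Φ : A) : Prop extends IsDoubleQuasiPoisson e br where
  momentMap : IsMomentMap e br Φ

/-- The gauge element `a ↦ a x ⊗ x - x ⊗ x a` of an idempotent `x`. -/
def gauge (k : Type*) [Field k] {A : Type*} [Ring A] [Algebra k A] (x : A) : A →ₗ[k] A ⊗[k] A :=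
  (TensorProduct.mk k A A).flip x ∘ₗ LinearMap.mulRight k x
    - TensorProduct.mk k A A x ∘ₗ LinearMap.mulLeft k x

theorem gauge_apply (x a : A) : gauge k x a = (a * x) ⊗ₜ[k] x - x ⊗ₜ[k] (x * a) := rfl

variable (k A) in
/-- `(d, f) ↦ f' d'' ⊗ d' f''`. -/
def contract : A ⊗[k] A →ₗ[k] A ⊗[k] A →ₗ[k] A ⊗[k] A :=
  TensorProduct.map₂ (LinearMap.mul k A).flip (LinearMap.mul k A) ∘ₗ
    (TensorProduct.comm k A A).toLinearMap

theorem contract_tmul (x y z w : A) :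
    contract k A (x ⊗ₜ[k] y) (z ⊗ₜ[k] w) = (z * y) ⊗ₜ[k] (x * w) := by
  simp [contract]

/-- The double bracket defined by the bivector `δ₁ δ₂`:
`⦃b, c⦄ = δ₂(c)' δ₁(b)'' ⊗ δ₁(b)' δ₂(c)'' - δ₁(c)' δ₂(b)'' ⊗ δ₂(b)' δ₁(c)''`. -/
def bivectorBracket (δ₁ δ₂ : A →ₗ[k] A ⊗[k] A) : A →ₗ[k] A →ₗ[k] A ⊗[k] A :=
  (contract k A).compl₁₂ δ₁ δ₂ - (contract k A).compl₁₂ δ₂ δ₁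

theorem IsDoubleBracket.leibniz_left {B : Subalgebra k A} {br : A →ₗ[k] A →ₗ[k] A ⊗[k] A}
    (h : IsDoubleBracket B br) (a b c : A) :
    br (a * b) c = (1 ⊗ₜ[k] a) * br b c + br a c * (b ⊗ₜ[k] 1) := by
  have key : ∀ u v : A ⊗[k] A, TensorProduct.comm k A A (u * v) =
      TensorProduct.comm k A A u * TensorProduct.comm k A A v := fun u v =>
    map_mul (Algebra.TensorProduct.comm k A A) u v
  rw [h.antisymm (a * b) c, h.leibniz, h.antisymm b c, h.antisymm a c, map_add, key, key]
  simp [add_comm]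

theorem gauge_isDoubleDerivation {I : Type*} [Fintype I] {e : I → A}
    (he : CompleteOrthogonalIdempotents e) (s : I) :
    IsDoubleDerivation (idemSubalgebra k e) (gauge k (e s)) := by
  have hl : ∀ a b : A, gauge k (e s) (a * b) =
      (a ⊗ₜ[k] 1) * gauge k (e s) b + gauge k (e s) a * (1 ⊗ₜ[k] b) := by
    intro a b
    simp [gauge_apply, mul_sub, sub_mul, mul_assoc]
  refine ⟨hl, fun b hb => ?_⟩
  induction hb using Algebra.adjoin_induction with
  | mem x hx =>
    obtain ⟨t, rfl⟩ := hx
    by_cases hst : t = s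
    · subst hst; simp [gauge_apply, (he.idem t).eq]
    · simp [gauge_apply, he.ortho hst, he.ortho (Ne.symm hst)]
  | algebraMap r =>
    simp [gauge_apply, Algebra.algebraMap_eq_smul_one]
  | add x y _ _ hx hy => rw [map_add, hx, hy, add_zero]
  | mul x y _ _ hx hy => rw [hl, hx, hy]; simp

end Basic

/-! ### Amalgamated free product of algebras -/

section Amalgam

variable {k : Type*} [Field k] {C A A' : Type*} [Ring C] [Algebra k C] [Ring A] [Algebra k A]
  [Ring A'] [Algebra k A']

/-- The relations that define the free product of `A` and `A'` over `C`. -/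
inductive AmalgRel (j : C →ₐ[k] A) (j' : C →ₐ[k] A') :
    TensorAlgebra k (A × A') → TensorAlgebra k (A × A') → Prop
  | left_mul (a b : A) : AmalgRel j j' (TensorAlgebra.ι k (a * b, 0))
      (TensorAlgebra.ι k (a, 0) * TensorAlgebra.ι k (b, 0))
  | right_mul (a b : A') : AmalgRel j j' (TensorAlgebra.ι k (0, a * b))
      (TensorAlgebra.ι k (0, a) * TensorAlgebra.ι k (0, b))
  | left_one : AmalgRel j j' (TensorAlgebra.ι k (1, 0)) 1
  | right_one : AmalgRel j j' (TensorAlgebra.ι k (0, 1)) 1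
  | amalg (c : C) : AmalgRel j j' (TensorAlgebra.ι k (j c, 0)) (TensorAlgebra.ι k (0, j' c))

/-- The free product `A ∗_C A'`, a quotient of the tensor algebra of `A ⊕ A'`. -/
def Amalgam (j : C →ₐ[k] A) (j' : C →ₐ[k] A') : Type _ := RingQuot (AmalgRel j j')

variable (j : C →ₐ[k] A) (j' : C →ₐ[k] A')

instance : Ring (Amalgam j j') := inferInstanceAs (Ring (RingQuot (AmalgRel j j')))

instance : Algebra k (Amalgam j j') := inferInstanceAs (Algebra k (RingQuot (AmalgRel j j')))

namespace Amalgam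

/-- The quotient map. -/
def mk : TensorAlgebra k (A × A') →ₐ[k] Amalgam j j' := RingQuot.mkAlgHom k (AmalgRel j j')

variable {j j'} in
theorem mk_rel {x y : TensorAlgebra k (A × A')} (h : AmalgRel j j' x y) : mk j j' x = mk j j' y :=
  RingQuot.mkAlgHom_rel k h

/-- The canonical map `A → A ∗_C A'`. -/
def inl : A →ₐ[k] Amalgam j j' :=
  AlgHom.ofLinearMap ((mk j j').toLinearMap ∘ₗ TensorAlgebra.ι k ∘ₗ LinearMap.inl k A A')
    (by simpa using mk_rel (AmalgRel.left_one (j := j) (j' := j')))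
    (fun a b => by simpa using mk_rel (AmalgRel.left_mul (j := j) (j' := j') a b))

/-- The canonical map `A' → A ∗_C A'`. -/
def inr : A' →ₐ[k] Amalgam j j' :=
  AlgHom.ofLinearMap ((mk j j').toLinearMap ∘ₗ TensorAlgebra.ι k ∘ₗ LinearMap.inr k A A')
    (by simpa using mk_rel (AmalgRel.right_one (j := j) (j' := j')))
    (fun a b => by simpa using mk_rel (AmalgRel.right_mul (j := j) (j' := j') a b))

theorem inl_apply (a : A) : inl j j' a = mk j j' (TensorAlgebra.ι k (a, 0)) := rfl

theorem inr_apply (a : A') : inr j j' a = mk j j' (TensorAlgebra.ι k (0, a)) := rfl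

theorem inl_eq_inr (c : C) : inl j j' (j c) = inr j j' (j' c) := mk_rel (AmalgRel.amalg c)

variable {j j'} in
/-- Induction over sums and products of elements of `A` and `A'`. -/
theorem induction {P : Amalgam j j' → Prop} (hl : ∀ a, P (inl j j' a)) (hr : ∀ a, P (inr j j' a))
    (hadd : ∀ x y, P x → P y → P (x + y)) (hmul : ∀ x y, P x → P y → P (x * y))
    (x : Amalgam j j') : P x := by
  obtain ⟨x, rfl⟩ := RingQuot.mkAlgHom_surjective k (AmalgRel j j') x
  change P (mk j j' x)
  induction x using TensorAlgebra.induction with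
  | algebraMap r => simpa using hl (algebraMap k A r)
  | ι m =>
    have : mk j j' (TensorAlgebra.ι k m) = inl j j' m.1 + inr j j' m.2 := by
      rw [inl_apply, inr_apply, ← map_add, ← map_add]; simp
    rw [this]
    exact hadd _ _ (hl _) (hr _)
  | mul x y hx hy => rw [map_mul]; exact hmul _ _ hx hy
  | add x y hx hy => rw [map_add]; exact hadd _ _ hx hy

variable {S : Type*} [Ring S] [Algebra k S]

variable {j j'} in
/-- The universal property of `A ∗_C A'`. -/
def lift (f : A →ₐ[k] S) (g : A' →ₐ[k] S) (h : ∀ c, f (j c) = g (j' c)) : Amalgam j j' →ₐ[k] S :=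
  RingQuot.liftAlgHom k ⟨TensorAlgebra.lift k (f.toLinearMap.coprod g.toLinearMap), by
    rintro _ _ (⟨a, b⟩ | ⟨a, b⟩ | _ | _ | c) <;> simp [h]⟩

variable {j j'} in
theorem lift_mk (f : A →ₐ[k] S) (g : A' →ₐ[k] S) (h : ∀ c, f (j c) = g (j' c))
    (x : TensorAlgebra k (A × A')) :
    lift f g h (mk j j' x) = TensorAlgebra.lift k (f.toLinearMap.coprod g.toLinearMap) x :=
  RingQuot.liftAlgHom_mkAlgHom_apply ..

variable {j j'} in
theorem lift_inl (f : A →ₐ[k] S) (g : A' →ₐ[k] S) (h : ∀ c, f (j c) = g (j' c)) (a : A) :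
    lift f g h (inl j j' a) = f a := by
  rw [inl_apply, lift_mk]; simp

variable {j j'} in
theorem lift_inr (f : A →ₐ[k] S) (g : A' →ₐ[k] S) (h : ∀ c, f (j c) = g (j' c)) (a : A') :
    lift f g h (inr j j' a) = g a := by
  rw [inr_apply, lift_mk]; simp

end Amalgam

/-- The algebra map `a ↦ (l a, d a; 0, r a)` attached to an `(l, r)`-derivation `d`. -/
def triHom {R S : Type*} [Ring R] [Algebra k R] [Ring S] [Algebra k S] (l r : R →ₐ[k] S)
    (d : R →ₗ[k] S) (hd : ∀ a b, d (a * b) = l a * d b + d a * r b) :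
    R →ₐ[k] Matrix (Fin 2) (Fin 2) S :=
  AlgHom.ofLinearMap
    { toFun := fun a => !![l a, d a; 0, r a]
      map_add' := fun a b => by ext i j; fin_cases i <;> fin_cases j <;> simp
      map_smul' := fun c a => by ext i j; fin_cases i <;> fin_cases j <;> simp }
    (by
      have h1 : d 1 = 0 := by simpa using hd 1 1
      ext i j; fin_cases i <;> fin_cases j <;> simp [h1])
    (fun a b => by
      ext i j; fin_cases i <;> fin_cases j <;> simp [hd, Matrix.mul_apply])

theorem triHom_apply {R S : Type*} [Ring R] [Algebra k R] [Ring S] [Algebra k S] (l r : R →ₐ[k] S)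
    (d : R →ₗ[k] S) (hd : ∀ a b, d (a * b) = l a * d b + d a * r b) (a : R) :
    triHom l r d hd a = !![l a, d a; 0, r a] := rfl

namespace Amalgam

variable {S : Type*} [Ring S] [Algebra k S]

section

variable {j j'}
variable (l r : Amalgam j j' →ₐ[k] S) (d : A →ₗ[k] S)
  (hd : ∀ a b, d (a * b) = l (inl j j' a) * d b + d a * r (inl j j' b)) (hj : ∀ c, d (j c) = 0)

/-- The algebra map on `A ∗_C A'` that is `(l, d; 0, r)` on `A` and `(l, 0; 0, r)` on `A'`. -/
def extendHom : Amalgam j j' →ₐ[k] Matrix (Fin 2) (Fin 2) S :=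
  lift (triHom (l.comp (inl j j')) (r.comp (inl j j')) d (fun a b => by simpa using hd a b))
    (triHom (l.comp (inr j j')) (r.comp (inr j j')) 0 (by simp))
    (fun c => by rw [triHom_apply, triHom_apply]; simp [hj, inl_eq_inr])

/-- The extension to `A ∗_C A'`, by zero on `A'`, of a derivation `d` on `A` that vanishes on `C`;
the bimodule structure of the target is given by the algebra maps `l` and `r`. -/
def extend : Amalgam j j' →ₗ[k] S :=
  Matrix.entryLinearMap k S (0 : Fin 2) (1 : Fin 2) ∘ₗ (extendHom l r d hd hj).toLinearMap

theorem extend_apply (x : Amalgam j j') : extend l r d hd hj x = extendHom l r d hd hj x 0 1 := rfl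

theorem extend_inl (a : A) : extend l r d hd hj (inl j j' a) = d a := by
  rw [extend_apply, extendHom, lift_inl, triHom_apply]; simp

theorem extend_inr (a : A') : extend l r d hd hj (inr j j' a) = 0 := by
  rw [extend_apply, extendHom, lift_inr, triHom_apply]; simp

theorem extendHom_apply (x : Amalgam j j') :
    extendHom l r d hd hj x = !![l x, extend l r d hd hj x; 0, r x] := by
  induction x using Amalgam.induction with
  | hl a => rw [extend_inl, extendHom, lift_inl, triHom_apply]; simp
  | hr a => rw [extend_inr, extendHom, lift_inr, triHom_apply]; simp
  | hadd x y hx hy =>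
    rw [map_add, hx, hy]; ext i j; fin_cases i <;> fin_cases j <;> simp
  | hmul x y hx hy =>
    rw [extend_apply, map_mul, hx, hy]
    ext i j; fin_cases i <;> fin_cases j <;> simp [Matrix.mul_apply]

theorem extend_mul (x y : Amalgam j j') :
    extend l r d hd hj (x * y) = l x * extend l r d hd hj y + extend l r d hd hj x * r y := by
  rw [extend_apply l r d hd hj (x * y), map_mul, extendHom_apply, extendHom_apply]
  simp [Matrix.mul_apply]

/-- Two derivations on `A ∗_C A'` that agree on `A` and on `A'` are equal. -/
theorem derivation_ext {D D' : Amalgam j j' →ₗ[k] S}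
    (hD : ∀ x y, D (x * y) = l x * D y + D x * r y)
    (hD' : ∀ x y, D' (x * y) = l x * D' y + D' x * r y)
    (h1 : ∀ a, D (inl j j' a) = D' (inl j j' a)) (h2 : ∀ a, D (inr j j' a) = D' (inr j j' a)) :
    D = D' := by
  ext x
  induction x using Amalgam.induction with
  | hl a => exact h1 a
  | hr a => exact h2 a
  | hadd x y hx hy => rw [map_add, map_add, hx, hy]
  | hmul x y hx hy => rw [hD, hD', hx, hy]

end

section Induced

variable {j j'}

variable (j j') in
/-- `i ⊗ i` for the canonical map `i : A → A ∗_C A'`. -/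
def inlTensor : A ⊗[k] A →ₐ[k] Amalgam j j' ⊗[k] Amalgam j j' :=
  Algebra.TensorProduct.map (inl j j') (inl j j')

theorem inlTensor_tmul (a b : A) :
    inlTensor j j' (a ⊗ₜ[k] b) = inl j j' a ⊗ₜ[k] inl j j' b := rfl

/-- The image in `A ∗_C A'` of a double derivation on `A` that vanishes on `B ⊇ j(C)`: it extends
the given one and vanishes on `A'`. -/
def pushDer {B : Subalgebra k A} (hB : ∀ c, j c ∈ B) {δ : A →ₗ[k] A ⊗[k] A}
    (hδ : IsDoubleDerivation B δ) : Amalgam j j' →ₗ[k] Amalgam j j' ⊗[k] Amalgam j j' :=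
  extend Algebra.TensorProduct.includeLeft Algebra.TensorProduct.includeRight
    ((inlTensor j j').toLinearMap ∘ₗ δ)
    (fun a b => by simp [hδ.leibniz, inlTensor_tmul])
    (fun c => by simp [hδ.vanish _ (hB c)])

section

variable {B : Subalgebra k A} (hB : ∀ c, j c ∈ B) {br : A →ₗ[k] A →ₗ[k] A ⊗[k] A}
  (hbr : IsDoubleBracket B br)

/-- The extension of `⦃a, -⦄` to `A ∗_C A'`, for `a` in `A`. -/
def pushRight (a : A) : Amalgam j j' →ₗ[k] Amalgam j j' ⊗[k] Amalgam j j' :=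
  extend Algebra.TensorProduct.includeLeft Algebra.TensorProduct.includeRight
    ((inlTensor j j').toLinearMap ∘ₗ br a)
    (fun b c => by simp [hbr.leibniz, inlTensor_tmul, add_comm])
    (fun c => by simp [hbr.vanish_right _ (hB c)])

theorem pushRight_mul (a : A) (x y : Amalgam j j') :
    pushRight hB hbr a (x * y) =
      (x ⊗ₜ[k] 1) * pushRight hB hbr a y + pushRight hB hbr a x * (1 ⊗ₜ[k] y) :=
  extend_mul _ _ _ _ _ x y

theorem pushRight_inl (a b : A) :
    pushRight hB hbr a (inl j j' b) = inlTensor j j' (br a b) :=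
  extend_inl _ _ _ _ _ b

theorem pushRight_inr (a : A) (b : A') :
    pushRight hB hbr a (inr j j' b) = 0 :=
  extend_inr _ _ _ _ _ b

/-- `pushRight` as a linear map in both arguments. -/
def pushRightₗ : A →ₗ[k] Amalgam j j' →ₗ[k] Amalgam j j' ⊗[k] Amalgam j j' where
  toFun := pushRight hB hbr
  map_add' a b := by
    refine derivation_ext Algebra.TensorProduct.includeLeft Algebra.TensorProduct.includeRight
      (pushRight_mul hB hbr _) (fun x y => ?_) (fun c => ?_) (fun c => ?_)
    · simp only [LinearMap.add_apply, pushRight_mul, mul_add, add_mul,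
        Algebra.TensorProduct.includeLeft_apply, Algebra.TensorProduct.includeRight_apply]
      abel
    · simp [pushRight_inl]
    · simp [pushRight_inr]
  map_smul' t a := by
    refine derivation_ext Algebra.TensorProduct.includeLeft Algebra.TensorProduct.includeRight
      (pushRight_mul hB hbr _) (fun x y => ?_) (fun c => ?_) (fun c => ?_)
    · simp [pushRight_mul]
    · simp [pushRight_inl]
    · simp [pushRight_inr]

theorem pushRight_mul_left (a b : A) (x : Amalgam j j') :
    pushRight hB hbr (a * b) x = (1 ⊗ₜ[k] inl j j' a) * pushRight hB hbr b x
      + pushRight hB hbr a x * (inl j j' b ⊗ₜ[k] 1) := by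
  have h1 : ∀ u v : Amalgam j j', ((1 : Amalgam j j') ⊗ₜ[k] u) * (v ⊗ₜ[k] (1 : Amalgam j j')) =
      (v ⊗ₜ[k] 1) * (1 ⊗ₜ[k] u) := fun u v => by simp
  induction x using Amalgam.induction with
  | hl c => simp [pushRight_inl, hbr.leibniz_left, inlTensor_tmul]
  | hr c => simp [pushRight_inr]
  | hadd x y hx hy => simp only [map_add, hx, hy, mul_add, add_mul]; abel
  | hmul x y hx hy =>
    simp only [pushRight_mul, hx, hy, mul_add, add_mul]
    rw [← mul_assoc (1 ⊗ₜ[k] inl j j' a) (x ⊗ₜ[k] 1), h1, mul_assoc (pushRight hB hbr a x) _ _,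
      ← h1 y]
    simp only [mul_assoc]
    abel

/-- The extension of `⦃-, x⦄` to `A ∗_C A'`, for `x` in `A ∗_C A'`. -/
def pushLeft (x : Amalgam j j') : Amalgam j j' →ₗ[k] Amalgam j j' ⊗[k] Amalgam j j' :=
  extend Algebra.TensorProduct.includeRight Algebra.TensorProduct.includeLeft
    ((pushRightₗ hB hbr).flip x)
    (fun a b => pushRight_mul_left hB hbr a b x)
    (fun c => by
      change pushRight hB hbr (j c) x = 0
      have h0 : br (j c) = 0 := LinearMap.ext fun a => hbr.vanish_left _ (hB c) a
      induction x using Amalgam.induction with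
      | hl c => simp [pushRight_inl, h0]
      | hr c => simp [pushRight_inr]
      | hadd x y hx hy => simp only [map_add, hx, hy, add_zero]
      | hmul x y hx hy => simp [pushRight_mul, hx, hy])

theorem pushLeft_mul (z x y : Amalgam j j') :
    pushLeft hB hbr z (x * y) =
      (1 ⊗ₜ[k] x) * pushLeft hB hbr z y + pushLeft hB hbr z x * (y ⊗ₜ[k] 1) :=
  extend_mul _ _ _ _ _ x y

theorem pushLeft_inl (x : Amalgam j j') (a : A) :
    pushLeft hB hbr x (inl j j' a) = pushRight hB hbr a x :=
  extend_inl _ _ _ _ _ a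

theorem pushLeft_inr (x : Amalgam j j') (a : A') :
    pushLeft hB hbr x (inr j j' a) = 0 :=
  extend_inr _ _ _ _ _ a

/-- The bracket on `A ∗_C A'` induced by a double bracket on `A` that is linear over `B ⊇ j(C)`:
it extends the given one (`pushBracket_inl_inl`), vanishes as soon as one argument is in `A'`
(`pushBracket_inr_left`, `pushBracket_inr_right`), and is a derivation in both arguments. -/
def pushBracket : Amalgam j j' →ₗ[k] Amalgam j j' →ₗ[k] Amalgam j j' ⊗[k] Amalgam j j' :=
  LinearMap.flip
  { toFun := pushLeft hB hbr
    map_add' := fun x y => by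
      refine derivation_ext Algebra.TensorProduct.includeRight Algebra.TensorProduct.includeLeft
        (pushLeft_mul hB hbr _) (fun x y => ?_) (fun c => ?_) (fun c => ?_)
      · simp only [LinearMap.add_apply, pushLeft_mul, mul_add, add_mul,
          Algebra.TensorProduct.includeLeft_apply, Algebra.TensorProduct.includeRight_apply]
        abel
      · simp [pushLeft_inl]
      · simp [pushLeft_inr]
    map_smul' := fun t x => by
      refine derivation_ext Algebra.TensorProduct.includeRight Algebra.TensorProduct.includeLeft
        (pushLeft_mul hB hbr _) (fun x y => ?_) (fun c => ?_) (fun c => ?_)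
      · simp [pushLeft_mul]
      · simp [pushLeft_inl]
      · simp [pushLeft_inr] }

theorem pushBracket_apply (x y : Amalgam j j') :
    pushBracket hB hbr x y = pushLeft hB hbr y x := rfl

theorem pushBracket_inl_inl (a b : A) :
    pushBracket hB hbr (inl j j' a) (inl j j' b) = inlTensor j j' (br a b) := by
  rw [pushBracket_apply, pushLeft_inl, pushRight_inl]

theorem pushBracket_mul_left (x y z : Amalgam j j') :
    pushBracket hB hbr (x * y) z =
      (1 ⊗ₜ[k] x) * pushBracket hB hbr y z + pushBracket hB hbr x z * (y ⊗ₜ[k] 1) := by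
  simp only [pushBracket_apply, pushLeft_mul]

theorem pushBracket_inr_left (a : A') (x : Amalgam j j') :
    pushBracket hB hbr (inr j j' a) x = 0 := by
  rw [pushBracket_apply, pushLeft_inr]

theorem pushBracket_inr_right (x : Amalgam j j') (a : A') :
    pushBracket hB hbr x (inr j j' a) = 0 := by
  induction x using Amalgam.induction with
  | hl b => rw [pushBracket_apply, pushLeft_inl, pushRight_inr]
  | hr b => exact pushBracket_inr_left hB hbr b _
  | hadd x y hx hy => rw [map_add, LinearMap.add_apply, hx, hy, add_zero]
  | hmul x y hx hy => rw [pushBracket_mul_left, hx, hy, mul_zero, zero_mul, add_zero]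

end

end Induced

end Amalgam

end Amalgam

/-! ### The fusion algebra -/

section Fusion

variable {k : Type*} [Field k] {A : Type*} [Ring A] [Algebra k A] {I : Type*} [Fintype I]
  {e : I → A} (he : CompleteOrthogonalIdempotents e) {p q : I} (hpq : p ≠ q)

variable (k) in
/-- The map `k e_p ⊕ k e_q ⊕ k μ → A`, with `μ = 1 - e_p - e_q`. -/
def baseMap : (k × k × k) →ₐ[k] A :=
  AlgHom.ofLinearMap
    { toFun := fun c => c.1 • e p + c.2.1 • e q + c.2.2 • (1 - e p - e q)
      map_add' := fun c d => by simp only [Prod.fst_add, Prod.snd_add, add_smul]; abel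
      map_smul' := fun t c => by simp [smul_smul, smul_add] }
    (by simp)
    (fun c d => by
      have h1 := (he.idem p).eq
      have h2 := (he.idem q).eq
      have h3 := he.ortho hpq
      have h4 := he.ortho hpq.symm
      simp only [LinearMap.coe_mk, AddHom.coe_mk, Prod.fst_mul, Prod.snd_mul, add_mul, mul_add,
        smul_mul_smul_comm, h1, h2, h3, h4, sub_mul, mul_sub, one_mul, mul_one, smul_zero,
        sub_self, sub_zero, add_zero, zero_add])

variable (k) in
/-- The map `k e_p ⊕ k e_q ⊕ k μ → Mat₂(k) ⊕ k μ`. -/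
def matMap : (k × k × k) →ₐ[k] (Matrix (Fin 2) (Fin 2) k × k) :=
  AlgHom.prod
    ((Matrix.diagonalAlgHom k).comp
      (AlgHom.pi (R := k) (A := fun _ : Fin 2 => k)
        ![AlgHom.fst k k (k × k), (AlgHom.fst k k k).comp (AlgHom.snd k k (k × k))]))
    ((AlgHom.snd k k k).comp (AlgHom.snd k k (k × k)))

variable (k) in
/-- The extension algebra `A ∗_{k e_p ⊕ k e_q ⊕ k μ} (Mat₂(k) ⊕ k μ)` of `A` along `(e_p, e_q)`. -/
abbrev ExtAlgebra : Type _ := Amalgam (baseMap k he hpq) (matMap k)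

variable (k) in
/-- The canonical map from `A` to the extension algebra. -/
def toExt : A →ₐ[k] ExtAlgebra k he hpq := Amalgam.inl _ _

variable (k) in
/-- The matrix unit `e_{12}` in the extension algebra; the index `1` of `Mat₂(k)` belongs to
`e_p`, and the index `2` to `e_q`. -/
def unit12 : ExtAlgebra k he hpq := Amalgam.inr _ _ (Matrix.single 0 1 1, 0)

variable (k) in
/-- The matrix unit `e_{21}` in the extension algebra. -/
def unit21 : ExtAlgebra k he hpq := Amalgam.inr _ _ (Matrix.single 1 0 1, 0)

variable (k) in
/-- The idempotent `ε = 1 - e_q` of the extension algebra. -/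
def eps : ExtAlgebra k he hpq := 1 - toExt k he hpq (e q)

variable (k) in
theorem eps_idem : IsIdempotentElem (eps k he hpq) :=
  ((he.idem q).map (toExt k he hpq)).one_sub

variable (k) in
/-- The fusion algebra `A^f = ε Ā ε`, obtained by fusing `e_q` onto `e_p`; its unit is `ε`. -/
abbrev FusionAlgebra : Type _ := (eps_idem k he hpq).Corner

/-- Scalars act on a corner `x R x` as on `R`. -/
@[reducible] def cornerModule {R : Type*} [Ring R] [Algebra k R] {x : R} (hx : IsIdempotentElem x) :
    Module k hx.Corner where
  smul t r := ⟨t • r.1, by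
    obtain ⟨y, hy⟩ := r.2
    exact ⟨t • y, by simp [← hy]⟩⟩
  one_smul r := Subtype.ext (one_smul k r.1)
  mul_smul s t r := Subtype.ext (mul_smul s t r.1)
  smul_zero t := Subtype.ext (smul_zero t)
  smul_add t r s := Subtype.ext (smul_add t r.1 s.1)
  add_smul s t r := Subtype.ext (add_smul s t r.1)
  zero_smul r := Subtype.ext (zero_smul k r.1)

instance cornerAlgebra {R : Type*} [Ring R] [Algebra k R] {x : R} (hx : IsIdempotentElem x) :
    Algebra k hx.Corner :=
  letI := cornerModule (k := k) hx
  Algebra.ofModule (fun t r s => Subtype.ext (smul_mul_assoc t r.1 s.1))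
    (fun t r s => Subtype.ext (mul_smul_comm t r.1 s.1))

/-- The inclusion `x R x → R`. -/
def cornerVal {R : Type*} [Ring R] [Algebra k R] {x : R} (hx : IsIdempotentElem x) :
    hx.Corner →ₗ[k] R where
  toFun r := r.1
  map_add' _ _ := rfl
  map_smul' _ _ := rfl

/-- The projection `R → x R x`, `r ↦ x r x`. -/
def cornerProj {R : Type*} [Ring R] [Algebra k R] {x : R} (hx : IsIdempotentElem x) :
    R →ₗ[k] hx.Corner where
  toFun r := ⟨x * r * x, ⟨r, rfl⟩⟩
  map_add' r s := Subtype.ext (by change x * (r + s) * x = x * r * x + x * s * x; noncomm_ring)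
  map_smul' t r := Subtype.ext (by change x * (t • r) * x = t • (x * r * x); simp)

variable (k) in
/-- The projection `x ↦ ε x ε` onto the fusion algebra. -/
def cut : ExtAlgebra k he hpq →ₗ[k] FusionAlgebra k he hpq := cornerProj (eps_idem k he hpq)

variable (k) in
/-- The trace map `Tr : A → A^f`, `a ↦ ε a ε + ε e_{12} a e_{21} ε`. -/
def trace (a : A) : FusionAlgebra k he hpq :=
  cut k he hpq (toExt k he hpq a)
    + cut k he hpq (unit12 k he hpq * toExt k he hpq a * unit21 k he hpq)

/-- The trace of a double derivation `δ` of the extension algebra, that is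
`ε δ ε + ε e_{12} δ e_{21} ε` for the inner bimodule structure:
`a ↦ δ(a)' ε ⊗ ε δ(a)'' + δ(a)' e_{21} ε ⊗ ε e_{12} δ(a)''`. -/
def traceDer (δ : ExtAlgebra k he hpq →ₗ[k] ExtAlgebra k he hpq ⊗[k] ExtAlgebra k he hpq) :
    FusionAlgebra k he hpq →ₗ[k] FusionAlgebra k he hpq ⊗[k] FusionAlgebra k he hpq :=
  (TensorProduct.map (cut k he hpq) (cut k he hpq)
    + TensorProduct.map (cut k he hpq ∘ₗ LinearMap.mulRight k (unit21 k he hpq))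
        (cut k he hpq ∘ₗ LinearMap.mulLeft k (unit12 k he hpq)))
    ∘ₗ δ ∘ₗ cornerVal (eps_idem k he hpq)

theorem baseMap_mem (c : k × k × k) : baseMap k he hpq c ∈ idemSubalgebra k e := by
  have h : ∀ s, e s ∈ idemSubalgebra k e := fun s => Algebra.subset_adjoin ⟨s, rfl⟩
  change c.1 • e p + c.2.1 • e q + c.2.2 • (1 - e p - e q) ∈ _
  exact add_mem (add_mem (Subalgebra.smul_mem _ (h p) _) (Subalgebra.smul_mem _ (h q) _))
    (Subalgebra.smul_mem _ (sub_mem (sub_mem (one_mem _) (h p)) (h q)) _)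

variable (k) in
/-- The double derivation `Tr(E_s)` of the fusion algebra, for the gauge element `E_s` of `A`. -/
def traceGauge (s : I) :
    FusionAlgebra k he hpq →ₗ[k] FusionAlgebra k he hpq ⊗[k] FusionAlgebra k he hpq :=
  traceDer he hpq (Amalgam.pushDer (baseMap_mem he hpq) (gauge_isDoubleDerivation (k := k) he s))

/-- The bracket on the fusion algebra induced by a double bracket on `A`. -/
def inducedBracket {br : A →ₗ[k] A →ₗ[k] A ⊗[k] A}
    (hbr : IsDoubleBracket (idemSubalgebra k e) br) :
    FusionAlgebra k he hpq →ₗ[k] FusionAlgebra k he hpq →ₗ[k]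
      FusionAlgebra k he hpq ⊗[k] FusionAlgebra k he hpq :=
  ((Amalgam.pushBracket (j' := matMap k) (baseMap_mem he hpq) hbr).compl₁₂
    (cornerVal (eps_idem k he hpq)) (cornerVal (eps_idem k he hpq))).compr₂
    (TensorProduct.map (cut k he hpq) (cut k he hpq))

/-- The bracket `⦃-,-⦄^f = ⦃-,-⦄ + ⦃-,-⦄_fus` on the fusion algebra, where `⦃-,-⦄_fus` is defined
by the bivector `-½ Tr(E_p) Tr(E_q)`. -/
def fusionBracket {br : A →ₗ[k] A →ₗ[k] A ⊗[k] A}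
    (hbr : IsDoubleBracket (idemSubalgebra k e) br) :
    FusionAlgebra k he hpq →ₗ[k] FusionAlgebra k he hpq →ₗ[k]
      FusionAlgebra k he hpq ⊗[k] FusionAlgebra k he hpq :=
  inducedBracket he hpq hbr
    + bivectorBracket (-(1 / 2 : k) • traceGauge k he hpq p) (traceGauge k he hpq q)

variable (k) in
/-- The idempotents `e_s`, `s ≠ q`, of the fusion algebra. -/
def fusionIdem (s : {s : I // s ≠ q}) : FusionAlgebra k he hpq :=
  cut k he hpq (toExt k he hpq (e s))

variable (k) in
/-- `Φ^f = e_p Tr(Φ_p) Tr(Φ_q) e_p + ∑_{s ≠ p, q} e_s Tr(Φ_s) e_s`, where `Φ_s = e_s Φ e_s`. -/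
def fusionMomentMap [DecidableEq I] (Φ : A) : FusionAlgebra k he hpq :=
  fusionIdem k he hpq ⟨p, hpq⟩ * trace k he hpq (e p * Φ * e p) * trace k he hpq (e q * Φ * e q)
      * fusionIdem k he hpq ⟨p, hpq⟩
    + ∑ s : {s : I // s ≠ q}, if s.1 = p then 0 else
        fusionIdem k he hpq s * trace k he hpq (e s * Φ * e s) * fusionIdem k he hpq s

end Fusion

end

end DoubleBracket

/-!
Everything happens in the extension algebra `Ā`. The fusion bracket is the restriction to the corner
`A^f = ε Ā ε` of the bracket `⦃-,-⦄ + ⦃-,-⦄_fus` on `Ā` whose bivector is formed by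
`Tr(E_p) = E_p` and `Tr(E_q) = e₁₂ ∗ E_q ∗ e₂₁`.

Both sides of the quasi-Poisson condition are cyclically invariant and derivations in their last
argument, so that it can be checked on the image of `A`. There `E_p` and `Tr(E_q)` are inner: they
are the commutators with `e_p ⊗ e_p` and with `e₂₁ ⊗ e₁₂`. Hence the terms of the triple bracket
that mix the two summands cancel. The triple bracket of the bivector is the difference between the
cubic term of the gauge element `E_p + Tr(E_q)` of the fused idempotent and those of `E_p` and
`E_q`.

For the moment map, `Φ_p` and `e₁₂ Φ_q e₂₁` satisfy the moment map identities for `E_p` and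
`Tr(E_q)`; the bivector supplies exactly what is missing from the identity of their product for
`E_p + Tr(E_q)`. Finite generation passes to the corner since `ε` is a full idempotent: inserting
`1 = ε + e₂₁ ε e₁₂` between the generators of `Ā` writes each product of them with products of
elements of `A^f`.
-/

namespace DoubleBracket

set_option maxSynthPendingDepth 3

noncomputable section

/-! ### Contractions, double derivations and triple brackets -/

section Tensor

variable {k : Type*} [Field k] {R : Type*} [Ring R] [Algebra k R]

theorem comm_mul (x y : R ⊗[k] R) : TensorProduct.comm k R R (x * y) =
    TensorProduct.comm k R R x * TensorProduct.comm k R R y :=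
  map_mul (Algebra.TensorProduct.comm k R R) x y

theorem tau_tmul (a b c : R) : tau k R (a ⊗ₜ[k] b ⊗ₜ[k] c) = c ⊗ₜ[k] a ⊗ₜ[k] b := rfl

theorem tau_mul (x y : (R ⊗[k] R) ⊗[k] R) : tau k R (x * y) = tau k R x * tau k R y :=
  map_mul ((Algebra.TensorProduct.comm k (R ⊗[k] R) R).trans
    (Algebra.TensorProduct.assoc k k k R R R).symm) x y

theorem tau_tau_tau (x : (R ⊗[k] R) ⊗[k] R) : tau k R (tau k R (tau k R x)) = x := by
  have : tau k R ∘ₗ tau k R ∘ₗ tau k R = LinearMap.id := by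
    ext a b c; simp [tau_tmul]
  exact LinearMap.congr_fun this x

/-- The inner bimodule action `w ↦ x ∗ w ∗ y`, that is `w' y ⊗ x w''`. -/
def innerMul (x y : R) : R ⊗[k] R →ₗ[k] R ⊗[k] R :=
  TensorProduct.map (LinearMap.mulRight k y) (LinearMap.mulLeft k x)

theorem innerMul_tmul (x y z w : R) :
    innerMul x y (z ⊗ₜ[k] w) = (z * y) ⊗ₜ[k] (x * w) := rfl

theorem innerMul_apply (x y : R) (w : R ⊗[k] R) :
    innerMul x y w = (1 ⊗ₜ[k] x) * w * (y ⊗ₜ[k] 1) := by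
  induction w using TensorProduct.induction_on with
  | zero => simp
  | add w w' hw hw' => simp only [map_add, hw, hw', mul_add, add_mul]
  | tmul z w => simp [innerMul_tmul]

theorem tmul_one_mul_comm (x y : R) :
    ((x ⊗ₜ[k] (1 : R)) * (1 ⊗ₜ[k] y) : R ⊗[k] R) = (1 ⊗ₜ[k] y) * (x ⊗ₜ[k] 1) := by
  simp

theorem innerMul_mul_left (x y a : R) (w : R ⊗[k] R) :
    innerMul x y ((a ⊗ₜ[k] 1) * w) = (a ⊗ₜ[k] 1) * innerMul x y w := by
  simp only [innerMul_apply, ← mul_assoc, tmul_one_mul_comm]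

theorem innerMul_mul_right (x y a : R) (w : R ⊗[k] R) :
    innerMul x y (w * (1 ⊗ₜ[k] a)) = innerMul x y w * (1 ⊗ₜ[k] a) := by
  simp only [innerMul_apply, mul_assoc, tmul_one_mul_comm]

theorem innerMul_innerMul (x y x' y' : R) (w : R ⊗[k] R) :
    innerMul x y (innerMul x' y' w) = innerMul (x * x') (y' * y) w := by
  have : innerMul x y ∘ₗ innerMul x' y' = innerMul (k := k) (x * x') (y' * y) := by
    ext z w; simp [innerMul_tmul, mul_assoc]
  exact LinearMap.congr_fun this w

theorem contract_tmul_left (x y : R) : contract k R (x ⊗ₜ[k] y) = innerMul x y := by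
  ext z w; simp [contract_tmul, innerMul_tmul]

theorem contract_mul_left (d f : R ⊗[k] R) (a : R) :
    contract k R d ((a ⊗ₜ[k] 1) * f) = (a ⊗ₜ[k] 1) * contract k R d f := by
  induction d using TensorProduct.induction_on with
  | zero => simp
  | add d d' hd hd' => simp [hd, hd', mul_add]
  | tmul x y => simp only [contract_tmul_left, innerMul_mul_left]

theorem contract_mul_right (d f : R ⊗[k] R) (a : R) :
    contract k R d (f * (1 ⊗ₜ[k] a)) = contract k R d f * (1 ⊗ₜ[k] a) := by
  induction d using TensorProduct.induction_on with
  | zero => simp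
  | add d d' hd hd' => simp [hd, hd', add_mul]
  | tmul x y => simp only [contract_tmul_left, innerMul_mul_right]

theorem comm_contract (d f : R ⊗[k] R) :
    TensorProduct.comm k R R (contract k R d f) = contract k R f d := by
  have : (contract k R).compr₂ (TensorProduct.comm k R R).toLinearMap = (contract k R).flip := by
    ext x y z w; simp [contract_tmul]
  exact LinearMap.congr_fun₂ this d f

variable (k R) in
/-- `(d, f) ↦ f' ⊗ d'' ⊗ d' f''`, used to write `contract₃` as a composite of linear maps. -/
def chain : R ⊗[k] R →ₗ[k] R ⊗[k] R →ₗ[k] (R ⊗[k] R) ⊗[k] R :=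
  TensorProduct.map₂ (TensorProduct.mk k R R).flip (LinearMap.mul k R) ∘ₗ
    (TensorProduct.comm k R R).toLinearMap

variable (k R) in
/-- The cyclic contraction `(d₁, d₂, d₃) ↦ d₃' d₁'' ⊗ d₁' d₂'' ⊗ d₂' d₃''`: the right-hand side of
the quasi-Poisson condition is a sum of contractions of three values of `gauge k (e s)`. -/
def contract₃ :
    R ⊗[k] R →ₗ[k] R ⊗[k] R →ₗ[k] R ⊗[k] R →ₗ[k] (R ⊗[k] R) ⊗[k] R :=
  LinearMap.lcomp k _ (chain k R) ∘ₗ LinearMap.llcomp k _ _ _ ∘ₗ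
    LinearMap.rTensorHom R ∘ₗ contract k R

theorem contract₃_tmul (x y z w r s : R) :
    contract₃ k R (x ⊗ₜ[k] y) (z ⊗ₜ[k] w) (r ⊗ₜ[k] s) =
      (r * y) ⊗ₜ[k] (x * w) ⊗ₜ[k] (z * s) := by
  simp [contract₃, chain, contract_tmul]

theorem tau_contract₃ (c d f : R ⊗[k] R) :
    tau k R (contract₃ k R d f c) = contract₃ k R c d f := by
  have : (contract₃ k R).compr₂ (LinearMap.llcomp k _ _ _ (tau k R)) =
      LinearMap.lflip.toLinearMap ∘ₗ (contract₃ k R).flip := by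
    ext d d' f f' c c'
    simp [contract₃_tmul, tau_tmul]
  exact LinearMap.congr_fun (LinearMap.congr_fun₂ this d f) c

theorem contract₃_mul_left (c d f : R ⊗[k] R) (a : R) :
    contract₃ k R c d ((a ⊗ₜ[k] 1) * f) = (a ⊗ₜ[k] 1 ⊗ₜ[k] 1) * contract₃ k R c d f := by
  have : (contract₃ k R).compr₂ (LinearMap.lcomp k _ (LinearMap.mulLeft k (a ⊗ₜ[k] 1))) =
      (contract₃ k R).compr₂ (LinearMap.llcomp k _ _ _ (LinearMap.mulLeft k (a ⊗ₜ 1 ⊗ₜ 1))) := by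
    ext c c' d d' f f'
    simp [contract₃_tmul, mul_assoc]
  exact LinearMap.congr_fun (LinearMap.congr_fun₂ this c d) f

theorem contract₃_mul_right (c d f : R ⊗[k] R) (a : R) :
    contract₃ k R c d (f * (1 ⊗ₜ[k] a)) = contract₃ k R c d f * (1 ⊗ₜ[k] 1 ⊗ₜ[k] a) := by
  have : (contract₃ k R).compr₂ (LinearMap.lcomp k _ (LinearMap.mulRight k (1 ⊗ₜ[k] a))) =
      (contract₃ k R).compr₂ (LinearMap.llcomp k _ _ _ (LinearMap.mulRight k (1 ⊗ₜ 1 ⊗ₜ a))) := by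
    ext c c' d d' f f'
    simp [contract₃_tmul, mul_assoc]
  exact LinearMap.congr_fun (LinearMap.congr_fun₂ this c d) f

theorem quasiPoisson_term_eq_contract₃ {x : R} (hx : IsIdempotentElem x) (a b c : R) :
    (c * x * a) ⊗ₜ[k] (x * b) ⊗ₜ[k] x - (c * x * a) ⊗ₜ[k] x ⊗ₜ[k] (b * x)
    - (c * x) ⊗ₜ[k] (a * x * b) ⊗ₜ[k] x + (c * x) ⊗ₜ[k] (a * x) ⊗ₜ[k] (b * x)
    - (x * a) ⊗ₜ[k] (x * b) ⊗ₜ[k] (x * c) + (x * a) ⊗ₜ[k] x ⊗ₜ[k] (b * x * c)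
    + x ⊗ₜ[k] (a * x * b) ⊗ₜ[k] (x * c) - x ⊗ₜ[k] (a * x) ⊗ₜ[k] (b * x * c) =
      contract₃ k R (gauge k x a) (gauge k x b) (gauge k x c) := by
  have hxx : ∀ y, x * (x * y) = x * y := fun y => by rw [← mul_assoc, hx.eq]
  simp only [gauge_apply, map_sub, LinearMap.sub_apply, contract₃_tmul, mul_assoc, hx.eq, hxx]
  abel

end Tensor

section Derivations

variable {k : Type*} [Field k] {R : Type*} [Ring R] [Algebra k R] {B : Subalgebra k R}
  {δ δ' : R →ₗ[k] R ⊗[k] R}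

theorem isDoubleDerivation_adjoin {S : Set R}
    (hl : ∀ a b, δ (a * b) = (a ⊗ₜ[k] 1) * δ b + δ a * (1 ⊗ₜ[k] b)) (hS : ∀ x ∈ S, δ x = 0) :
    IsDoubleDerivation (Algebra.adjoin k S) δ := by
  refine ⟨hl, fun x hx => ?_⟩
  have map_one : δ 1 = 0 := by
    have leibniz_one := hl 1 1
    rwa [← Algebra.TensorProduct.one_def, mul_one, mul_one, one_mul, left_eq_add] at leibniz_one
  induction hx using Algebra.adjoin_induction with
  | mem x hx => exact hS x hx
  | algebraMap r => rw [Algebra.algebraMap_eq_smul_one, map_smul, map_one, smul_zero]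
  | add x y _ _ hx hy => rw [map_add, hx, hy, add_zero]
  | mul x y _ _ hx hy => rw [hl, hx, hy, mul_zero, zero_mul, add_zero]

theorem IsDoubleDerivation.add (h : IsDoubleDerivation B δ) (h' : IsDoubleDerivation B δ') :
    IsDoubleDerivation B (δ + δ') where
  leibniz a b := by
    simp only [LinearMap.add_apply, h.leibniz, h'.leibniz, add_mul, mul_add]
    abel
  vanish b hb := by rw [LinearMap.add_apply, h.vanish b hb, h'.vanish b hb, add_zero]

theorem IsDoubleDerivation.smul (h : IsDoubleDerivation B δ) (t : k) :
    IsDoubleDerivation B (t • δ) where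
  leibniz a b := by
    simp only [LinearMap.smul_apply, h.leibniz, smul_add, smul_mul_assoc, mul_smul_comm]
  vanish b hb := by rw [LinearMap.smul_apply, h.vanish b hb, smul_zero]

theorem IsDoubleDerivation.innerMul_comp (h : IsDoubleDerivation B δ) (x y : R) :
    IsDoubleDerivation B (innerMul x y ∘ₗ δ) where
  leibniz a b := by
    simp only [LinearMap.comp_apply, h.leibniz, map_add, innerMul_mul_left, innerMul_mul_right]
  vanish b hb := by rw [LinearMap.comp_apply, h.vanish b hb, map_zero]

theorem IsDoubleDerivation.mul_mul (h : IsDoubleDerivation B δ) {x y : R} (hx : x ∈ B)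
    (hy : y ∈ B) (a : R) : δ (x * a * y) = (x ⊗ₜ[k] 1) * δ a * (1 ⊗ₜ[k] y) := by
  rw [h.leibniz, h.leibniz, h.vanish x hx, h.vanish y hy, mul_zero, zero_add, zero_mul, add_zero]

/-- The inner double derivation `a ↦ a t - t a` for the outer bimodule structure. -/
def innerDer (t : R ⊗[k] R) : R →ₗ[k] R ⊗[k] R :=
  LinearMap.mulRight k t ∘ₗ (Algebra.TensorProduct.includeLeft : R →ₐ[k] R ⊗[k] R).toLinearMap
    - LinearMap.mulLeft k t ∘ₗ (Algebra.TensorProduct.includeRight : R →ₐ[k] R ⊗[k] R).toLinearMap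

theorem innerDer_apply (t : R ⊗[k] R) (a : R) :
    innerDer t a = (a ⊗ₜ[k] 1) * t - t * (1 ⊗ₜ[k] a) := rfl

theorem innerDer_add (t t' : R ⊗[k] R) : innerDer (t + t') = innerDer t + innerDer t' :=
  LinearMap.ext fun a => by
    simp only [innerDer_apply, LinearMap.add_apply, mul_add, add_mul]
    abel

theorem innerDer_tmul (x y a : R) :
    innerDer (x ⊗ₜ[k] y) a = (a * x) ⊗ₜ[k] y - x ⊗ₜ[k] (y * a) := by
  simp [innerDer_apply]

theorem innerDer_mul (t : R ⊗[k] R) (a b : R) :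
    innerDer t (a * b) = (a ⊗ₜ[k] 1) * innerDer t b + innerDer t a * (1 ⊗ₜ[k] b) := by
  have mul_tmul_one : (a * b) ⊗ₜ[k] (1 : R) = (a ⊗ₜ[k] 1) * (b ⊗ₜ[k] 1) := by simp
  have one_tmul_mul : (1 : R) ⊗ₜ[k] (a * b) = (1 ⊗ₜ[k] a) * (1 ⊗ₜ[k] b) := by simp
  rw [innerDer_apply, innerDer_apply, innerDer_apply, mul_tmul_one, one_tmul_mul]
  noncomm_ring

theorem gauge_eq_innerDer (x : R) : gauge k x = innerDer (x ⊗ₜ[k] x) := by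
  ext a; rw [gauge_apply, innerDer_tmul]

end Derivations

section Brackets

variable {k : Type*} [Field k] {R : Type*} [Ring R] [Algebra k R] {B : Subalgebra k R}
  {br br' : R →ₗ[k] R →ₗ[k] R ⊗[k] R}

theorem isDoubleBracket_adjoin {S : Set R}
    (ha : ∀ a b : R, br a b = -TensorProduct.comm k R R (br b a))
    (hl : ∀ a b c : R, br a (b * c) = br a b * (1 ⊗ₜ[k] c) + (b ⊗ₜ[k] 1) * br a c)
    (hS : ∀ x ∈ S, ∀ a, br a x = 0) : IsDoubleBracket (Algebra.adjoin k S) br := by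
  have vanish_right : ∀ b ∈ Algebra.adjoin k S, ∀ a, br a b = 0 := fun b hb a =>
    (isDoubleDerivation_adjoin (δ := br a) (fun x y => by rw [hl, add_comm])
      (fun x hx => hS x hx a)).vanish b hb
  exact ⟨ha, hl, fun b hb a => by rw [ha, vanish_right b hb, map_zero, neg_zero], vanish_right⟩

theorem IsDoubleBracket.isDoubleDerivation (h : IsDoubleBracket B br) (a : R) :
    IsDoubleDerivation B (br a) where
  leibniz b c := by rw [h.leibniz, add_comm]
  vanish b hb := h.vanish_right b hb a

theorem IsDoubleBracket.add (h : IsDoubleBracket B br) (h' : IsDoubleBracket B br') :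
    IsDoubleBracket B (br + br') where
  antisymm a b := by
    rw [LinearMap.add_apply, LinearMap.add_apply, h.antisymm, h'.antisymm, LinearMap.add_apply,
      LinearMap.add_apply, map_add, neg_add]
  leibniz a b c := by
    simp only [LinearMap.add_apply, h.leibniz, h'.leibniz, add_mul, mul_add]
    abel
  vanish_left b hb a := by simp [h.vanish_left b hb, h'.vanish_left b hb]
  vanish_right b hb a := by simp [h.vanish_right b hb, h'.vanish_right b hb]

theorem IsDoubleBracket.smul (h : IsDoubleBracket B br) (t : k) : IsDoubleBracket B (t • br) where
  antisymm a b := by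
    rw [LinearMap.smul_apply, LinearMap.smul_apply, h.antisymm, LinearMap.smul_apply,
      LinearMap.smul_apply, map_smul, smul_neg]
  leibniz a b c := by simp [h.leibniz]
  vanish_left b hb a := by simp [h.vanish_left b hb]
  vanish_right b hb a := by simp [h.vanish_right b hb]

theorem bivectorBracket_apply (δ₁ δ₂ : R →ₗ[k] R ⊗[k] R) (b c : R) :
    bivectorBracket δ₁ δ₂ b c = contract k R (δ₁ b) (δ₂ c) - contract k R (δ₂ b) (δ₁ c) := rfl

theorem bivectorBracket_smul (t : k) (δ₁ δ₂ : R →ₗ[k] R ⊗[k] R) :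
    bivectorBracket (t • δ₁) δ₂ = t • bivectorBracket δ₁ δ₂ := by
  refine LinearMap.ext₂ fun b c => ?_
  simp [bivectorBracket_apply, smul_sub]

theorem isDoubleBracket_bivectorBracket {δ₁ δ₂ : R →ₗ[k] R ⊗[k] R}
    (h₁ : IsDoubleDerivation B δ₁) (h₂ : IsDoubleDerivation B δ₂) :
    IsDoubleBracket B (bivectorBracket δ₁ δ₂) where
  antisymm a b := by simp [bivectorBracket_apply, comm_contract]
  leibniz a b c := by
    simp only [bivectorBracket_apply, h₁.leibniz, h₂.leibniz, map_add, contract_mul_left,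
      contract_mul_right, sub_mul, mul_sub]
    abel
  vanish_left b hb a := by simp [bivectorBracket_apply, h₁.vanish b hb, h₂.vanish b hb]
  vanish_right b hb a := by simp [bivectorBracket_apply, h₁.vanish b hb, h₂.vanish b hb]

end Brackets

section TripleBracket

variable {k : Type*} [Field k] {R : Type*} [Ring R] [Algebra k R] {B : Subalgebra k R}
  {br : R →ₗ[k] R →ₗ[k] R ⊗[k] R}

theorem brLeft_tmul (a x y : R) : brLeft br a (x ⊗ₜ[k] y) = br a x ⊗ₜ[k] y := rfl

theorem tau_tripleBracket (a b c : R) :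
    tau k R (tripleBracket br b c a) = tripleBracket br a b c := by
  simp only [tripleBracket, map_add, tau_tau_tau]
  abel

theorem brLeft_mul_right (b c : R) (w : R ⊗[k] R) :
    brLeft br b (w * (1 ⊗ₜ[k] c)) = brLeft br b w * (1 ⊗ₜ[k] 1 ⊗ₜ[k] c) := by
  have : brLeft br b ∘ₗ LinearMap.mulRight k (1 ⊗ₜ[k] c) =
      LinearMap.mulRight k ((1 : R) ⊗ₜ[k] (1 : R) ⊗ₜ[k] c) ∘ₗ brLeft br b := by
    ext x y; simp [brLeft_tmul, ← Algebra.TensorProduct.one_def]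
  exact LinearMap.congr_fun this w

theorem brLeft_inner_mul_left (b c : R) (w : R ⊗[k] R) :
    brLeft br b ((1 ⊗ₜ[k] c) * w) = (1 ⊗ₜ[k] 1 ⊗ₜ[k] c) * brLeft br b w := by
  have : brLeft br b ∘ₗ LinearMap.mulLeft k (1 ⊗ₜ[k] c) =
      LinearMap.mulLeft k ((1 : R) ⊗ₜ[k] (1 : R) ⊗ₜ[k] c) ∘ₗ brLeft br b := by
    ext x y; simp [brLeft_tmul, ← Algebra.TensorProduct.one_def]
  exact LinearMap.congr_fun this w

namespace IsDoubleBracket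

variable (h : IsDoubleBracket B br)

include h

theorem brLeft_mul_left (a c : R) (w : R ⊗[k] R) :
    brLeft br a ((c ⊗ₜ[k] 1) * w) = (c ⊗ₜ[k] 1 ⊗ₜ[k] 1) * brLeft br a w
      + (br a c ⊗ₜ[k] 1) * (TensorProduct.assoc k R R R).symm (1 ⊗ₜ[k] w) := by
  induction w using TensorProduct.induction_on with
  | zero => simp
  | add x y hx hy => simp only [mul_add, map_add, hx, hy, TensorProduct.tmul_add]; abel
  | tmul x y => simp [brLeft_tmul, h.leibniz, TensorProduct.add_tmul, add_comm]

theorem tau_brLeft_inner_mul_right (b d : R) (w : R ⊗[k] R) :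
    tau k R (brLeft br b (w * (d ⊗ₜ[k] 1))) =
      tau k R (brLeft br b w) * (1 ⊗ₜ[k] 1 ⊗ₜ[k] d) + (TensorProduct.comm k R R w ⊗ₜ[k] 1) *
        (TensorProduct.assoc k R R R).symm (1 ⊗ₜ[k] br b d) := by
  induction w using TensorProduct.induction_on with
  | zero => simp
  | add x y hx hy => simp only [add_mul, map_add, hx, hy, TensorProduct.add_tmul]; abel
  | tmul x y =>
    have tau_left (t : R ⊗[k] R) : tau k R (((x ⊗ₜ[k] 1) * t) ⊗ₜ[k] y) =
        ((y ⊗ₜ[k] x) ⊗ₜ[k] 1) * (TensorProduct.assoc k R R R).symm (1 ⊗ₜ[k] t) := by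
      induction t using TensorProduct.induction_on with
      | zero => simp
      | add t t' ht ht' => simp only [mul_add, TensorProduct.add_tmul, TensorProduct.tmul_add,
          map_add, ht, ht']
      | tmul t t' => simp [tau_tmul]
    have tau_right : tau k R ((br b x * (1 ⊗ₜ[k] d)) ⊗ₜ[k] y) =
        tau k R (br b x ⊗ₜ[k] y) * (1 ⊗ₜ[k] 1 ⊗ₜ[k] d) := by
      rw [← tau_tmul, ← tau_mul, Algebra.TensorProduct.tmul_mul_tmul, mul_one]
    rw [Algebra.TensorProduct.tmul_mul_tmul, mul_one, brLeft_tmul, h.leibniz,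
      TensorProduct.add_tmul, map_add, tau_left, tau_right, brLeft_tmul, TensorProduct.comm_tmul]

theorem brLeft_mul (c d : R) (w : R ⊗[k] R) :
    brLeft br (c * d) w = (1 ⊗ₜ[k] c ⊗ₜ[k] 1) * brLeft br d w
      + brLeft br c w * (d ⊗ₜ[k] 1 ⊗ₜ[k] 1) := by
  induction w using TensorProduct.induction_on with
  | zero => simp
  | add x y hx hy => simp only [add_mul, mul_add, map_add, hx, hy]; abel
  | tmul x y => simp [brLeft_tmul, h.leibniz_left, TensorProduct.add_tmul]

/-- Antisymmetry cancels the two terms in which both factors of `c * d` are bracketed. -/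
theorem tripleBracket_mul (a b c d : R) :
    tripleBracket br a b (c * d) = (c ⊗ₜ[k] 1 ⊗ₜ[k] 1) * tripleBracket br a b d
      + tripleBracket br a b c * (1 ⊗ₜ[k] 1 ⊗ₜ[k] d) := by
  have neg_left (x : R ⊗[k] R) (y : (R ⊗[k] R) ⊗[k] R) :
      ((-x) ⊗ₜ[k] 1) * y = -((x ⊗ₜ[k] 1) * y) := by
    rw [TensorProduct.neg_tmul, neg_mul]
  rw [tripleBracket, h.leibniz, h.leibniz_left, map_add, map_add, map_add, brLeft_mul_right,
    h.brLeft_mul_left, h.tau_brLeft_inner_mul_right, brLeft_inner_mul_left, h.brLeft_mul, map_add,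
    map_add, tau_mul, tau_mul, tau_mul, tau_mul, tau_mul, tau_tmul, tau_tmul, tau_tmul, tau_tmul,
    tau_tmul, h.antisymm a c, neg_left, tripleBracket, tripleBracket]
  simp only [mul_add, add_mul]
  abel

theorem mul_mul_left {x y : R} (hx : x ∈ B) (hy : y ∈ B) (a b : R) :
    br (x * a * y) b = innerMul x y (br a b) := by
  rw [h.leibniz_left, h.leibniz_left, h.vanish_left x hx, h.vanish_left y hy, mul_zero, zero_mul,
    zero_add, add_zero, innerMul_apply]

end IsDoubleBracket

end TripleBracket

section Transport

variable {k : Type*} [Field k] {R S : Type*} [Ring R] [Algebra k R] [Ring S] [Algebra k S]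

theorem map_tau (f : R →ₗ[k] S) (w : (R ⊗[k] R) ⊗[k] R) :
    TensorProduct.map (TensorProduct.map f f) f (tau k R w) =
      tau k S (TensorProduct.map (TensorProduct.map f f) f w) := by
  have : TensorProduct.map (TensorProduct.map f f) f ∘ₗ tau k R =
      tau k S ∘ₗ TensorProduct.map (TensorProduct.map f f) f := by
    ext a b c; simp [tau_tmul]
  exact LinearMap.congr_fun this w

variable {f : R →ₗ[k] S}

theorem map_contract (hf : ∀ x y, f (x * y) = f x * f y) (c d : R ⊗[k] R) :
    TensorProduct.map f f (contract k R c d) =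
      contract k S (TensorProduct.map f f c) (TensorProduct.map f f d) := by
  have : (contract k R).compr₂ (TensorProduct.map f f) =
      (contract k S).compl₁₂ (TensorProduct.map f f) (TensorProduct.map f f) := by
    ext x y z w; simp [contract_tmul, hf]
  exact LinearMap.congr_fun₂ this c d

theorem map_contract₃ (hf : ∀ x y, f (x * y) = f x * f y) (c d g : R ⊗[k] R) :
    TensorProduct.map (TensorProduct.map f f) f (contract₃ k R c d g) =
      contract₃ k S (TensorProduct.map f f c) (TensorProduct.map f f d)
        (TensorProduct.map f f g) := by
  have : (contract₃ k R).compr₂ (LinearMap.llcomp k _ _ _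
        (TensorProduct.map (TensorProduct.map f f) f)) =
      ((contract₃ k S).compl₁₂ (TensorProduct.map f f) (TensorProduct.map f f)).compr₂
        (LinearMap.lcomp k _ (TensorProduct.map f f)) := by
    ext x y z w r s; simp [contract₃_tmul, hf]
  exact LinearMap.congr_fun (LinearMap.congr_fun₂ this c d) g

theorem map_gauge (hf : ∀ x y, f (x * y) = f x * f y) (x a : R) :
    TensorProduct.map f f (gauge k x a) = gauge k (f x) (f a) := by
  simp [gauge_apply, hf]

theorem map_tripleBracket {br : R →ₗ[k] R →ₗ[k] R ⊗[k] R} {br' : S →ₗ[k] S →ₗ[k] S ⊗[k] S}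
    (h : ∀ a b, TensorProduct.map f f (br a b) = br' (f a) (f b)) (a b c : R) :
    TensorProduct.map (TensorProduct.map f f) f (tripleBracket br a b c) =
      tripleBracket br' (f a) (f b) (f c) := by
  have map_brLeft (a : R) (w : R ⊗[k] R) :
      TensorProduct.map (TensorProduct.map f f) f (brLeft br a w) =
        brLeft br' (f a) (TensorProduct.map f f w) := by
    have : TensorProduct.map (TensorProduct.map f f) f ∘ₗ brLeft br a =
        brLeft br' (f a) ∘ₗ TensorProduct.map f f := by
      ext x y; simp [brLeft_tmul, h]
    exact LinearMap.congr_fun this w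
  simp only [tripleBracket, map_add, map_tau, map_brLeft, h]

end Transport

/-! ### The bivector of a pair of matrix units -/

section MixedTripleBracket

variable {k : Type*} [Field k] {R : Type*} [Ring R] [Algebra k R]

/-- The polarisation of `tripleBracket`, which is quadratic in the bracket. -/
def mixedTripleBracket (P Q : R →ₗ[k] R →ₗ[k] R ⊗[k] R) (a b c : R) : (R ⊗[k] R) ⊗[k] R :=
  brLeft P a (Q b c) + tau k R (brLeft P b (Q c a)) + tau k R (tau k R (brLeft P c (Q a b)))

theorem brLeft_add_smul (P F : R →ₗ[k] R →ₗ[k] R ⊗[k] R) (t : k) (a : R) (w : R ⊗[k] R) :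
    brLeft (P + t • F) a w = brLeft P a w + t • brLeft F a w := by
  rw [brLeft, LinearMap.add_apply, LinearMap.smul_apply, LinearMap.rTensor_add,
    LinearMap.rTensor_smul]
  rfl

theorem tripleBracket_add_smul (P F : R →ₗ[k] R →ₗ[k] R ⊗[k] R) (t : k) (a b c : R) :
    tripleBracket (P + t • F) a b c = tripleBracket P a b c
      + t • (mixedTripleBracket P F a b c + mixedTripleBracket F P a b c)
      + (t * t) • tripleBracket F a b c := by
  simp only [tripleBracket, mixedTripleBracket, brLeft_add_smul, LinearMap.add_apply,
    LinearMap.smul_apply, map_add, map_smul]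
  module

end MixedTripleBracket

section Wedge

variable {k : Type*} [Field k] {R : Type*} [Ring R] [Algebra k R] {u v : R}

variable (k) in
/-- The bracket of the bivector formed by the inner double derivations of `1 ⊗ 1` and `u ⊗ v`. For
`u = e₂₁`, `v = e₁₂` it computes the fusion bracket on the elements of `A`. -/
def wedgeBracket (u v : R) : R →ₗ[k] R →ₗ[k] R ⊗[k] R :=
  bivectorBracket (innerDer (1 ⊗ₜ[k] 1)) (innerDer (u ⊗ₜ[k] v))

theorem wedgeBracket_apply (a x : R) :
    wedgeBracket k u v a x = (x * u) ⊗ₜ[k] (a * v) - (x * u * a) ⊗ₜ[k] v - u ⊗ₜ[k] (a * v * x)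
      + (u * a) ⊗ₜ[k] (v * x) - (x * v) ⊗ₜ[k] (a * u) + (x * v * a) ⊗ₜ[k] u
      + v ⊗ₜ[k] (a * u * x) - (v * a) ⊗ₜ[k] (u * x) := by
  simp only [wedgeBracket, bivectorBracket_apply, innerDer_tmul, one_mul, mul_one, map_sub,
    LinearMap.sub_apply, contract_tmul, mul_assoc]
  abel

variable (k) in
/-- The part of `⦃a, ⦃b, c⦄'⦄ ⊗ ⦃b, c⦄''` that is linear in `w = ⦃a, b⦄`, where the inner bracket
is `wedgeBracket k u v` and the outer one is linear over `u` and `v`. -/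
def wedgeLeft (u v c : R) : R ⊗[k] R →ₗ[k] (R ⊗[k] R) ⊗[k] R :=
  (TensorProduct.mk k (R ⊗[k] R) R).flip (v * c) ∘ₗ LinearMap.mulLeft k (u ⊗ₜ[k] 1)
    - (TensorProduct.mk k (R ⊗[k] R) R).flip v ∘ₗ LinearMap.mulLeft k ((c * u) ⊗ₜ[k] 1)
    - (TensorProduct.mk k (R ⊗[k] R) R).flip (u * c) ∘ₗ LinearMap.mulLeft k (v ⊗ₜ[k] 1)
    + (TensorProduct.mk k (R ⊗[k] R) R).flip u ∘ₗ LinearMap.mulLeft k ((c * v) ⊗ₜ[k] 1)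

variable (k) in
/-- The part of `⦃a, ⦃b, c⦄'⦄ ⊗ ⦃b, c⦄''` that is linear in `w = ⦃a, c⦄`, where the inner bracket
is `wedgeBracket k u v` and the outer one is linear over `u` and `v`. -/
def wedgeRight (u v b : R) : R ⊗[k] R →ₗ[k] (R ⊗[k] R) ⊗[k] R :=
  (TensorProduct.mk k (R ⊗[k] R) R).flip (b * v) ∘ₗ LinearMap.mulRight k (1 ⊗ₜ[k] u)
    - (TensorProduct.mk k (R ⊗[k] R) R).flip v ∘ₗ LinearMap.mulRight k (1 ⊗ₜ[k] (u * b))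
    - (TensorProduct.mk k (R ⊗[k] R) R).flip (b * u) ∘ₗ LinearMap.mulRight k (1 ⊗ₜ[k] v)
    + (TensorProduct.mk k (R ⊗[k] R) R).flip u ∘ₗ LinearMap.mulRight k (1 ⊗ₜ[k] (v * b))

theorem wedgeLeft_apply (c : R) (w : R ⊗[k] R) : wedgeLeft k u v c w =
    ((u ⊗ₜ[k] 1) * w) ⊗ₜ[k] (v * c) - (((c * u) ⊗ₜ[k] 1) * w) ⊗ₜ[k] v
      - ((v ⊗ₜ[k] 1) * w) ⊗ₜ[k] (u * c) + (((c * v) ⊗ₜ[k] 1) * w) ⊗ₜ[k] u := rfl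

theorem wedgeRight_apply (b : R) (w : R ⊗[k] R) : wedgeRight k u v b w =
    (w * (1 ⊗ₜ[k] u)) ⊗ₜ[k] (b * v) - (w * (1 ⊗ₜ[k] (u * b))) ⊗ₜ[k] v
      - (w * (1 ⊗ₜ[k] v)) ⊗ₜ[k] (b * u) + (w * (1 ⊗ₜ[k] (v * b))) ⊗ₜ[k] u := rfl

theorem brLeft_wedgeBracket {B : Subalgebra k R} {br : R →ₗ[k] R →ₗ[k] R ⊗[k] R}
    (hbr : IsDoubleBracket B br) (hu : u ∈ B) (hv : v ∈ B) (a b c : R) :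
    brLeft br a (wedgeBracket k u v b c) =
      wedgeLeft k u v c (br a b) + wedgeRight k u v b (br a c) := by
  have one_tmul_mul : ∀ x y : R, (1 : R) ⊗ₜ[k] (x * y) = (1 ⊗ₜ[k] x) * (1 ⊗ₜ[k] y) := by simp
  have mul_tmul_one : ∀ x y : R, (x * y) ⊗ₜ[k] (1 : R) = (x ⊗ₜ[k] 1) * (y ⊗ₜ[k] 1) := by simp
  simp only [wedgeBracket_apply, map_sub, map_add, brLeft_tmul, hbr.leibniz,
    hbr.vanish_right u hu, hbr.vanish_right v hv, wedgeLeft_apply, wedgeRight_apply,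
    mul_zero, zero_mul, add_zero, zero_add, TensorProduct.zero_tmul, TensorProduct.add_tmul,
    one_tmul_mul, mul_tmul_one, mul_assoc]
  abel

theorem brLeft_wedgeBracket_apply (a : R) (w : R ⊗[k] R) :
    brLeft (wedgeBracket k u v) a w =
      tau k R (tau k R (wedgeRight k u v a (TensorProduct.comm k R R w)))
        - tau k R (wedgeLeft k u v a w) := by
  have : brLeft (wedgeBracket k u v) a =
      tau k R ∘ₗ tau k R ∘ₗ wedgeRight k u v a ∘ₗ (TensorProduct.comm k R R).toLinearMap
        - tau k R ∘ₗ wedgeLeft k u v a := by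
    ext x y
    simp only [TensorProduct.AlgebraTensorModule.curry_apply, TensorProduct.curry_apply,
      LinearMap.restrictScalars_self, LinearMap.sub_apply, LinearMap.comp_apply,
      LinearEquiv.coe_coe, brLeft_tmul, wedgeBracket_apply, wedgeLeft_apply, wedgeRight_apply,
      TensorProduct.comm_tmul, Algebra.TensorProduct.tmul_mul_tmul, one_mul, mul_one, map_sub,
      map_add, tau_tmul, TensorProduct.sub_tmul, TensorProduct.add_tmul, mul_assoc]
    abel
  exact LinearMap.congr_fun this w

/-- Expanding the two mixed triple brackets, each of the values `⦃a, b⦄`, `⦃b, c⦄`, `⦃c, a⦄` occurs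
once in `brLeft_wedgeBracket` and once, up to antisymmetry, in `brLeft_wedgeBracket_apply`. -/
theorem mixedTripleBracket_wedgeBracket {B : Subalgebra k R}
    {br : R →ₗ[k] R →ₗ[k] R ⊗[k] R} (hbr : IsDoubleBracket B br) (hu : u ∈ B) (hv : v ∈ B)
    (a b c : R) :
    mixedTripleBracket br (wedgeBracket k u v) a b c
      + mixedTripleBracket (wedgeBracket k u v) br a b c = 0 := by
  have comm_br (x y : R) : TensorProduct.comm k R R (br x y) = -br y x := by
    rw [hbr.antisymm y x, neg_neg]
  simp only [mixedTripleBracket, brLeft_wedgeBracket hbr hu hv, brLeft_wedgeBracket_apply, comm_br,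
    map_add, map_sub, map_neg, tau_tau_tau]
  abel

/-- The relations between the matrix units `u = e₂₁` and `v = e₁₂`. -/
structure IsUnitPair (u v : R) : Prop where
  uu : u * u = 0
  vv : v * v = 0
  uvu : u * (v * u) = u
  vuv : v * (u * v) = v

namespace IsUnitPair

variable (h : IsUnitPair u v)

include h

theorem bivectorBracket_innerDer :
    bivectorBracket (innerDer ((v * u) ⊗ₜ[k] (v * u))) (innerDer (u ⊗ₜ[k] v)) =
      wedgeBracket k u v := by
  have uvu' (y : R) : u * (v * (u * y)) = u * y := by rw [← mul_assoc v, ← mul_assoc u, h.uvu]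
  have vuv' (y : R) : v * (u * (v * y)) = v * y := by rw [← mul_assoc u, ← mul_assoc v, h.vuv]
  refine LinearMap.ext₂ fun a x => ?_
  simp only [wedgeBracket_apply, bivectorBracket_apply, innerDer_tmul, map_sub,
    LinearMap.sub_apply, contract_tmul, mul_assoc, uvu', vuv', h.uvu, h.vuv]
  abel

/-- The left-hand side is the triple bracket of any bracket that is linear over `u` and `v` and
agrees with `wedgeBracket k u v` on the values involved. -/
theorem cyclicSum_wedgeLeft_add_wedgeRight (a b c : R) :
    wedgeLeft k u v c (wedgeBracket k u v a b) + wedgeRight k u v b (wedgeBracket k u v a c)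
      + tau k R (wedgeLeft k u v a (wedgeBracket k u v b c)
        + wedgeRight k u v c (wedgeBracket k u v b a))
      + tau k R (tau k R (wedgeLeft k u v b (wedgeBracket k u v c a)
        + wedgeRight k u v a (wedgeBracket k u v c b))) =
    contract₃ k R (innerDer ((v * u) ⊗ₜ (v * u) + u ⊗ₜ v) a)
        (innerDer ((v * u) ⊗ₜ (v * u) + u ⊗ₜ v) b) (innerDer ((v * u) ⊗ₜ (v * u) + u ⊗ₜ v) c)
      - contract₃ k R (gauge k (v * u) a) (gauge k (v * u) b) (gauge k (v * u) c)
      - contract₃ k R (gauge k (u * v) a) (gauge k (u * v) b) (gauge k (u * v) c) := by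
  have uu' (y : R) : u * (u * y) = 0 := by rw [← mul_assoc, h.uu, zero_mul]
  have vv' (y : R) : v * (v * y) = 0 := by rw [← mul_assoc, h.vv, zero_mul]
  have uvu' (y : R) : u * (v * (u * y)) = u * y := by rw [← mul_assoc v, ← mul_assoc u, h.uvu]
  have vuv' (y : R) : v * (u * (v * y)) = v * y := by rw [← mul_assoc u, ← mul_assoc v, h.vuv]
  simp only [wedgeBracket_apply, wedgeLeft_apply, wedgeRight_apply,
    Algebra.TensorProduct.tmul_mul_tmul, one_mul, mul_one, mul_assoc, uu', vv', h.uu, h.vv,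
    mul_zero, TensorProduct.zero_tmul, TensorProduct.tmul_zero, add_zero, sub_zero, zero_sub,
    map_add, map_sub, map_neg, tau_tmul]
  simp only [gauge_eq_innerDer, innerDer_apply, mul_add, add_mul,
    Algebra.TensorProduct.tmul_mul_tmul, one_mul, mul_one, mul_assoc, map_add, map_sub,
    LinearMap.add_apply, LinearMap.sub_apply, contract₃_tmul, uvu', vuv', h.uvu, h.vuv]
  abel

/-- On the image of `i`, the mixed terms cancel and only the triple bracket of `P` and that of the
wedge bracket are left. -/
theorem tripleBracket_add_smul {B : Subalgebra k R} {P F : R →ₗ[k] R →ₗ[k] R ⊗[k] R}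
    (hP : IsDoubleBracket B P) (hF : IsDoubleBracket B F) (hu : u ∈ B) (hv : v ∈ B)
    {S : Type*} [Ring S] [Algebra k S] {br : S →ₗ[k] S →ₗ[k] S ⊗[k] S} (i : S →ₗ[k] R)
    (hPi : ∀ a b, P (i a) (i b) = TensorProduct.map i i (br a b))
    (hFi : ∀ a b, F (i a) (i b) = wedgeBracket k u v (i a) (i b)) (t : k) (a b c : S) :
    DoubleBracket.tripleBracket (P + t • F) (i a) (i b) (i c) =
      DoubleBracket.tripleBracket P (i a) (i b) (i c) + (t * t) •
        (contract₃ k R (innerDer ((v * u) ⊗ₜ (v * u) + u ⊗ₜ v) (i a))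
            (innerDer ((v * u) ⊗ₜ (v * u) + u ⊗ₜ v) (i b))
            (innerDer ((v * u) ⊗ₜ (v * u) + u ⊗ₜ v) (i c))
          - contract₃ k R (gauge k (v * u) (i a)) (gauge k (v * u) (i b)) (gauge k (v * u) (i c))
          - contract₃ k R (gauge k (u * v) (i a)) (gauge k (u * v) (i b))
              (gauge k (u * v) (i c))) := by
  have brLeft_map (a : S) (w : S ⊗[k] S) : brLeft F (i a) (TensorProduct.map i i w) =
      brLeft (wedgeBracket k u v) (i a) (TensorProduct.map i i w) := by
    have : brLeft F (i a) ∘ₗ TensorProduct.map i i =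
        brLeft (wedgeBracket k u v) (i a) ∘ₗ TensorProduct.map i i := by
      ext x y; simp [brLeft_tmul, hFi]
    exact LinearMap.congr_fun this w
  have mixed_eq_zero : mixedTripleBracket P F (i a) (i b) (i c)
      + mixedTripleBracket F P (i a) (i b) (i c) = 0 := by
    rw [← mixedTripleBracket_wedgeBracket hP hu hv (i a) (i b) (i c)]
    simp only [mixedTripleBracket, hFi, hPi, brLeft_map]
  have triple_eq := h.cyclicSum_wedgeLeft_add_wedgeRight (k := k) (i a) (i b) (i c)
  rw [DoubleBracket.tripleBracket_add_smul, mixed_eq_zero, smul_zero, add_zero, ← triple_eq]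
  simp only [DoubleBracket.tripleBracket, hFi, brLeft_wedgeBracket hF hu hv]

end IsUnitPair

end Wedge

section Moment

variable {k : Type*} [Field k] {R : Type*} [Ring R] [Algebra k R] {B : Subalgebra k R}
  {br : R →ₗ[k] R →ₗ[k] R ⊗[k] R}

/-- The moment map identity `⦃x, a⦄ = t (x ∗ δ(a) + δ(a) ∗ x)` for a double derivation `δ`; the
component `Φ_s` of a multiplicative moment map satisfies it for `δ = E_s` and `t = 1 / 2`. -/
def IsMomentFor (br : R →ₗ[k] R →ₗ[k] R ⊗[k] R) (t : k) (δ : R →ₗ[k] R ⊗[k] R) (x : R) : Prop :=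
  ∀ a, br x a = t • (innerMul x 1 (δ a) + innerMul 1 x (δ a))

theorem IsDoubleBracket.mul_left (h : IsDoubleBracket B br) (a b c : R) :
    br (a * b) c = innerMul a 1 (br b c) + innerMul 1 b (br a c) := by
  rw [h.leibniz_left, innerMul_apply, innerMul_apply, ← Algebra.TensorProduct.one_def, mul_one,
    one_mul]

/-- The bivector subtracts the terms `x ∗ δᵢ(a) ∗ y` of `⦃x * y, a⦄` and supplies the two terms of
the identity for `δ₁ + δ₂` that are missing there. -/
theorem IsMomentFor.mul (h : IsDoubleBracket B br) {t : k} {δ₁ δ₂ : R →ₗ[k] R ⊗[k] R} {e x y : R}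
    (hx : IsMomentFor br t δ₁ x) (hy : IsMomentFor br t δ₂ y)
    (h₁ : δ₁ (x * y) = x ⊗ₜ[k] y - e ⊗ₜ[k] (x * y))
    (h₂ : δ₂ (x * y) = (x * y) ⊗ₜ[k] e - x ⊗ₜ[k] y)
    (he₁ : ∀ a, innerMul 1 e (δ₁ a) = δ₁ a) (he₂ : ∀ a, innerMul e 1 (δ₂ a) = δ₂ a) :
    IsMomentFor (br + (-t) • bivectorBracket δ₁ δ₂) t (δ₁ + δ₂) (x * y) := by
  intro a
  have h₁' : innerMul (x * y) e (δ₁ a) = innerMul (x * y) 1 (δ₁ a) := by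
    simpa only [innerMul_innerMul, mul_one] using congrArg (innerMul (x * y) 1) (he₁ a)
  have h₂' : innerMul e (x * y) (δ₂ a) = innerMul 1 (x * y) (δ₂ a) := by
    simpa only [innerMul_innerMul, one_mul] using congrArg (innerMul 1 (x * y)) (he₂ a)
  rw [LinearMap.add_apply, LinearMap.add_apply, h.mul_left, hx, hy, LinearMap.smul_apply,
    LinearMap.smul_apply, bivectorBracket_apply, h₁, h₂, map_sub, map_sub, LinearMap.sub_apply,
    LinearMap.sub_apply, contract_tmul_left, contract_tmul_left, contract_tmul_left, h₁', h₂']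
  simp only [map_smul, map_add, LinearMap.add_apply, innerMul_innerMul, one_mul, mul_one]
  module

end Moment

/-! ### Determination on generators of an amalgamated product -/

section Triderivations

variable {k : Type*} [Field k] {R : Type*} [Ring R] [Algebra k R] {B : Subalgebra k R}

/-- A cyclically invariant map `T : R³ → R ⊗ R ⊗ R` that is a `B`-linear derivation in its last
argument. Both sides of the quasi-Poisson condition are of this kind, so that it can be checked on
generators. -/
structure IsCyclicTriderivation (B : Subalgebra k R) (T : R → R → R → (R ⊗[k] R) ⊗[k] R) :
    Prop where
  tau_apply : ∀ a b c, tau k R (T b c a) = T a b c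
  map_add : ∀ a b c d, T a b (c + d) = T a b c + T a b d
  leibniz : ∀ a b c d, T a b (c * d) =
    (c ⊗ₜ[k] 1 ⊗ₜ[k] 1) * T a b d + T a b c * (1 ⊗ₜ[k] 1 ⊗ₜ[k] d)
  vanish : ∀ a b, ∀ c ∈ B, T a b c = 0

theorem IsDoubleBracket.isCyclicTriderivation {br : R →ₗ[k] R →ₗ[k] R ⊗[k] R}
    (h : IsDoubleBracket B br) : IsCyclicTriderivation B (tripleBracket br) where
  tau_apply := tau_tripleBracket
  map_add a b c d := by
    have brLeft_add (w : R ⊗[k] R) : brLeft br (c + d) w = brLeft br c w + brLeft br d w := by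
      rw [brLeft, _root_.map_add, LinearMap.rTensor_add]
      rfl
    simp only [tripleBracket, _root_.map_add, LinearMap.add_apply, brLeft_add]
    abel
  leibniz := h.tripleBracket_mul
  vanish a b c hc := by
    have hc' : br c = 0 := LinearMap.ext (h.vanish_left c hc)
    simp [tripleBracket, brLeft, h.vanish_right c hc, hc']

theorem IsDoubleDerivation.isCyclicTriderivation {δ : R →ₗ[k] R ⊗[k] R}
    (h : IsDoubleDerivation B δ) :
    IsCyclicTriderivation B fun a b c => contract₃ k R (δ a) (δ b) (δ c) where
  tau_apply a b c := tau_contract₃ (δ a) (δ b) (δ c)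
  map_add a b c d := by rw [_root_.map_add, _root_.map_add]
  leibniz a b c d := by
    rw [h.leibniz, _root_.map_add, contract₃_mul_left, contract₃_mul_right]
  vanish a b c hc := by rw [h.vanish c hc, map_zero]

theorem IsCyclicTriderivation.smul_sum {J : Type*} [Fintype J]
    {T : J → R → R → R → (R ⊗[k] R) ⊗[k] R} (h : ∀ i, IsCyclicTriderivation B (T i)) (t : k) :
    IsCyclicTriderivation B fun a b c => t • ∑ i, T i a b c where
  tau_apply a b c := by simp only [map_smul, map_sum, (h _).tau_apply]
  map_add a b c d := by simp only [(h _).map_add, Finset.sum_add_distrib, smul_add]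
  leibniz a b c d := by
    simp only [(h _).leibniz, Finset.sum_add_distrib, smul_add, mul_smul_comm, smul_mul_assoc,
      Finset.mul_sum, Finset.sum_mul]
  vanish a b c hc := by simp only [(h _).vanish a b c hc, Finset.sum_const_zero, smul_zero]

end Triderivations

namespace Amalgam

variable {k : Type*} [Field k] {C A A' : Type*} [Ring C] [Algebra k C] [Ring A] [Algebra k A]
  [Ring A'] [Algebra k A'] {j : C →ₐ[k] A} {j' : C →ₐ[k] A'} {B : Subalgebra k A}

variable (j j' B) in
/-- The subalgebra of `A ∗_C A'` generated by `B ⊆ A` and by `A'`, over which the extensions to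
`A ∗_C A'` of the `B`-linear double derivations and double brackets of `A` are linear. -/
def base : Subalgebra k (Amalgam j j') := Algebra.adjoin k (inl j j' '' B ∪ Set.range (inr j j'))

theorem inl_mem_base {b : A} (hb : b ∈ B) : inl j j' b ∈ base j j' B :=
  Algebra.subset_adjoin (.inl ⟨b, hb, rfl⟩)

theorem inr_mem_base (b : A') : inr j j' b ∈ base j j' B :=
  Algebra.subset_adjoin (.inr ⟨b, rfl⟩)

section DoubleDerivation

variable {δ δ' : Amalgam j j' →ₗ[k] Amalgam j j' ⊗[k] Amalgam j j'}

theorem doubleDerivation_ext (h : IsDoubleDerivation (base j j' B) δ)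
    (h' : IsDoubleDerivation (base j j' B) δ') (hl : ∀ a, δ (inl j j' a) = δ' (inl j j' a)) :
    δ = δ' :=
  derivation_ext Algebra.TensorProduct.includeLeft Algebra.TensorProduct.includeRight
    h.leibniz h'.leibniz hl
    fun b => by rw [h.vanish _ (inr_mem_base b), h'.vanish _ (inr_mem_base b)]

theorem doubleDerivation_eq_innerDer (h : IsDoubleDerivation (base j j' B) δ)
    {t : Amalgam j j' ⊗[k] Amalgam j j'} (hl : ∀ a, δ (inl j j' a) = innerDer t (inl j j' a))
    (hr : ∀ b, innerDer t (inr j j' b) = 0) : δ = innerDer t :=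
  derivation_ext Algebra.TensorProduct.includeLeft Algebra.TensorProduct.includeRight
    h.leibniz (innerDer_mul t) hl fun b => by rw [h.vanish _ (inr_mem_base b), hr]

variable (hB : ∀ c, j c ∈ B) {δ : A →ₗ[k] A ⊗[k] A} (hδ : IsDoubleDerivation B δ)

theorem pushDer_inl (a : A) : pushDer hB hδ (inl j j' a) = inlTensor j j' (δ a) :=
  extend_inl _ _ _ _ _ a

theorem isDoubleDerivation_pushDer :
    IsDoubleDerivation (base j j' B) (pushDer (j' := j') hB hδ) := by
  refine isDoubleDerivation_adjoin (fun x y => extend_mul _ _ _ _ _ x y) ?_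
  rintro _ (⟨b, hb, rfl⟩ | ⟨b, rfl⟩)
  · rw [pushDer_inl, hδ.vanish b hb, map_zero]
  · exact extend_inr _ _ _ _ _ b

end DoubleDerivation

section Bracket

variable (hB : ∀ c, j c ∈ B) {br : A →ₗ[k] A →ₗ[k] A ⊗[k] A} (hbr : IsDoubleBracket B br)

theorem pushBracket_mul_right (x y z : Amalgam j j') :
    pushBracket hB hbr x (y * z) =
      pushBracket hB hbr x y * (1 ⊗ₜ[k] z) + (y ⊗ₜ[k] 1) * pushBracket hB hbr x z := by
  induction x using Amalgam.induction with
  | hl a => simp only [pushBracket_apply, pushLeft_inl, pushRight_mul, add_comm]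
  | hr a => simp [pushBracket_inr_left]
  | hadd x x' hx hx' =>
    simp only [map_add, LinearMap.add_apply, hx, hx', add_mul, mul_add]
    abel
  | hmul x x' hx hx' =>
    rw [pushBracket_mul_left, pushBracket_mul_left, pushBracket_mul_left, hx, hx', mul_add,
      add_mul, ← mul_assoc _ (y ⊗ₜ[k] 1), ← tmul_one_mul_comm, mul_assoc _ (1 ⊗ₜ[k] z),
      ← tmul_one_mul_comm]
    noncomm_ring

theorem pushBracket_antisymm (x y : Amalgam j j') : pushBracket hB hbr x y =
    -TensorProduct.comm k (Amalgam j j') (Amalgam j j') (pushBracket hB hbr y x) := by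
  induction x using Amalgam.induction with
  | hl a =>
    induction y using Amalgam.induction with
    | hl b =>
      have inlTensor_comm (w : A ⊗[k] A) : inlTensor j j' (TensorProduct.comm k A A w) =
          TensorProduct.comm k _ _ (inlTensor j j' w) :=
        TensorProduct.map_comm (inl j j').toLinearMap (inl j j').toLinearMap w
      rw [pushBracket_inl_inl, pushBracket_inl_inl, hbr.antisymm, map_neg, inlTensor_comm]
    | hr b => rw [pushBracket_inr_left, pushBracket_inr_right, map_zero, neg_zero]
    | hadd y y' hy hy' => rw [map_add, map_add, LinearMap.add_apply, hy, hy', map_add, neg_add]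
    | hmul y y' hy hy' =>
      rw [pushBracket_mul_right, pushBracket_mul_left, hy, hy', map_add, comm_mul, comm_mul]
      simp [add_comm]
  | hr a => rw [pushBracket_inr_left, pushBracket_inr_right, map_zero, neg_zero]
  | hadd x x' hx hx' => rw [map_add, map_add, LinearMap.add_apply, hx, hx', map_add, neg_add]
  | hmul x x' hx hx' =>
    rw [pushBracket_mul_right, pushBracket_mul_left, hx, hx', map_add, comm_mul, comm_mul]
    simp [add_comm]

theorem pushBracket_inl_right {b : A} (hb : b ∈ B) (x : Amalgam j j') :
    pushBracket hB hbr x (inl j j' b) = 0 := by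
  induction x using Amalgam.induction with
  | hl a => rw [pushBracket_inl_inl, hbr.vanish_right b hb, map_zero]
  | hr a => exact pushBracket_inr_left hB hbr a _
  | hadd x x' hx hx' => rw [map_add, LinearMap.add_apply, hx, hx', add_zero]
  | hmul x x' hx hx' => rw [pushBracket_mul_left, hx, hx', mul_zero, zero_mul, add_zero]

theorem isDoubleBracket_pushBracket :
    IsDoubleBracket (base j j' B) (pushBracket (j' := j') hB hbr) := by
  refine isDoubleBracket_adjoin (pushBracket_antisymm hB hbr) (pushBracket_mul_right hB hbr) ?_
  rintro _ (⟨b, hb, rfl⟩ | ⟨b, rfl⟩) x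
  · exact pushBracket_inl_right hB hbr hb x
  · exact pushBracket_inr_right hB hbr x b

end Bracket

theorem cyclicTriderivation_ext {T T' : Amalgam j j' → Amalgam j j' → Amalgam j j' →
      (Amalgam j j' ⊗[k] Amalgam j j') ⊗[k] Amalgam j j'}
    (h : IsCyclicTriderivation (base j j' B) T) (h' : IsCyclicTriderivation (base j j' B) T')
    (hl : ∀ a b c, T (inl j j' a) (inl j j' b) (inl j j' c) =
      T' (inl j j' a) (inl j j' b) (inl j j' c)) (x y z : Amalgam j j') : T x y z = T' x y z := by
  have ext_last (x y) (hxy : ∀ a, T x y (inl j j' a) = T' x y (inl j j' a)) (z) :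
      T x y z = T' x y z := by
    induction z using Amalgam.induction with
    | hl a => exact hxy a
    | hr b => rw [h.vanish x y _ (inr_mem_base b), h'.vanish x y _ (inr_mem_base b)]
    | hadd z z' hz hz' => rw [h.map_add, h'.map_add, hz, hz']
    | hmul z z' hz hz' => rw [h.leibniz, h'.leibniz, hz, hz']
  have rotate {x y z} (hxyz : T x y z = T' x y z) : T y z x = T' y z x := by
    rw [← h.tau_apply y z x, ← h.tau_apply z x y, ← h'.tau_apply y z x, ← h'.tau_apply z x y, hxyz]
  have ext_inl_inl (a b z) := ext_last _ _ (hl a b) z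
  have ext_inl (b z x) := ext_last (inl j j' b) z (fun a => rotate (ext_inl_inl a b z)) x
  exact ext_last x y (fun b => rotate (ext_inl b x y)) z

theorem finiteType (hA : Algebra.FiniteType k A) (hA' : Algebra.FiniteType k A') :
    Algebra.FiniteType k (Amalgam j j') := by
  have range_sup_range : (inl j j').range ⊔ (inr j j').range = ⊤ := by
    refine eq_top_iff.2 fun x _ => ?_
    induction x using Amalgam.induction with
    | hl a => exact le_sup_left (a := (inl j j').range) ⟨a, rfl⟩
    | hr b => exact le_sup_right (a := (inl j j').range) ⟨b, rfl⟩
    | hadd x y hx hy => exact add_mem (hx trivial) (hy trivial)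
    | hmul x y hx hy => exact mul_mem (hx trivial) (hy trivial)
  refine ⟨?_⟩
  rw [← range_sup_range, ← Algebra.map_top, ← Algebra.map_top]
  exact (hA.out.map _).sup (hA'.out.map _)

end Amalgam

/-! ### The fusion bracket on the extension algebra -/

section ExtensionAlgebra

variable {k : Type*} [Field k] {A : Type*} [Ring A] [Algebra k A] {I : Type*} [Fintype I]
  {e : I → A} (he : CompleteOrthogonalIdempotents e) {p q : I} (hpq : p ≠ q)

local notation "e₁₂" => unit12 k he hpq
local notation "e₂₁" => unit21 k he hpq
local notation "ε" => eps k he hpq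
local notation "ι" => toExt k he hpq

theorem matMap_apply (c : k × k × k) :
    matMap k c = (Matrix.diagonal ![c.1, c.2.1], c.2.2) := by
  refine Prod.ext ?_ rfl
  ext i j
  fin_cases i <;> fin_cases j <;> simp [matMap]

theorem toExt_baseMap (c : k × k × k) :
    ι (baseMap k he hpq c) = Amalgam.inr _ _ (Matrix.diagonal ![c.1, c.2.1], c.2.2) := by
  rw [toExt, Amalgam.inl_eq_inr, matMap_apply]

theorem unit12_mul_unit21 : e₁₂ * e₂₁ = ι (e p) := by
  have baseMap_eq : baseMap k he hpq (1, 0, 0) = e p := by simp [baseMap]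
  rw [← baseMap_eq, toExt_baseMap, unit12, unit21, ← map_mul]
  refine congrArg _ (Prod.ext ?_ (mul_zero _))
  ext i j
  fin_cases i <;> fin_cases j <;> simp

theorem unit21_mul_unit12 : e₂₁ * e₁₂ = ι (e q) := by
  have baseMap_eq : baseMap k he hpq (0, 1, 0) = e q := by simp [baseMap]
  rw [← baseMap_eq, toExt_baseMap, unit12, unit21, ← map_mul]
  refine congrArg _ (Prod.ext ?_ (mul_zero _))
  ext i j
  fin_cases i <;> fin_cases j <;> simp

theorem isUnitPair : IsUnitPair e₂₁ e₁₂ where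
  uu := (map_mul _ _ _).symm.trans ((congrArg _ (by simp)).trans (map_zero _))
  vv := (map_mul _ _ _).symm.trans ((congrArg _ (by simp)).trans (map_zero _))
  uvu := by simp [unit12, unit21, ← map_mul]
  vuv := by simp [unit12, unit21, ← map_mul]

theorem unit21_mul_toExt : e₂₁ * ι (e p) = e₂₁ := by
  rw [← unit12_mul_unit21, (isUnitPair he hpq).uvu]

theorem toExt_mul_unit12 : ι (e p) * e₁₂ = e₁₂ := by
  rw [← unit12_mul_unit21, mul_assoc, (isUnitPair he hpq).vuv]

theorem toExt_mul_unit21 : ι (e q) * e₂₁ = e₂₁ := by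
  rw [← unit21_mul_unit12, mul_assoc, (isUnitPair he hpq).uvu]

theorem unit12_mul_toExt : e₁₂ * ι (e q) = e₁₂ := by
  rw [← unit21_mul_unit12, (isUnitPair he hpq).vuv]

theorem inr_mem_adjoin (m : Matrix (Fin 2) (Fin 2) k × k) :
    Amalgam.inr (baseMap k he hpq) (matMap k) m ∈ Algebra.adjoin k {e₂₁, e₁₂} := by
  have inr_eq : Amalgam.inr _ _ m = m.1 0 0 • (e₁₂ * e₂₁) + m.1 0 1 • e₁₂ + m.1 1 0 • e₂₁
      + m.1 1 1 • (e₂₁ * e₁₂) + m.2 • (1 - e₁₂ * e₂₁ - e₂₁ * e₁₂) := by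
    simp only [unit12, unit21, ← map_mul, ← map_smul, ← map_add, ← map_sub,
      ← map_one (Amalgam.inr (baseMap k he hpq) (matMap k))]
    refine congrArg _ (Prod.ext ?_ (by simp))
    ext i j
    fin_cases i <;> fin_cases j <;> simp
  have hu : e₂₁ ∈ Algebra.adjoin k {e₂₁, e₁₂} := Algebra.subset_adjoin (.inl rfl)
  have hv : e₁₂ ∈ Algebra.adjoin k {e₂₁, e₁₂} := Algebra.subset_adjoin (.inr rfl)
  have hvu := mul_mem hv hu
  have huv := mul_mem hu hv
  rw [inr_eq]
  exact add_mem (add_mem (add_mem (add_mem (Subalgebra.smul_mem _ hvu _)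
    (Subalgebra.smul_mem _ hv _)) (Subalgebra.smul_mem _ hu _)) (Subalgebra.smul_mem _ huv _))
    (Subalgebra.smul_mem _ (sub_mem (sub_mem (one_mem _) hvu) huv) _)

variable (k) in
/-- The subalgebra of the extension algebra generated by the idempotents `e_s` and the matrix
units. -/
abbrev extBase : Subalgebra k (ExtAlgebra k he hpq) :=
  Amalgam.base (baseMap k he hpq) (matMap k) (idemSubalgebra k e)

theorem toExt_mem_extBase (s : I) : ι (e s) ∈ extBase k he hpq :=
  Amalgam.inl_mem_base (Algebra.subset_adjoin ⟨s, rfl⟩)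

theorem unit12_mem_extBase : e₁₂ ∈ extBase k he hpq := Amalgam.inr_mem_base _

theorem unit21_mem_extBase : e₂₁ ∈ extBase k he hpq := Amalgam.inr_mem_base _

variable (k) in
/-- The extension of the gauge element `E_s` to the extension algebra. -/
def extGauge (s : I) : ExtAlgebra k he hpq →ₗ[k] ExtAlgebra k he hpq ⊗[k] ExtAlgebra k he hpq :=
  Amalgam.pushDer (baseMap_mem he hpq) (gauge_isDoubleDerivation he s)

variable (k) in
/-- The double derivation `e₁₂ ∗ E_q ∗ e₂₁` of the extension algebra, which restricts to `Tr(E_q)`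
on the fusion algebra. -/
def conjGauge : ExtAlgebra k he hpq →ₗ[k] ExtAlgebra k he hpq ⊗[k] ExtAlgebra k he hpq :=
  innerMul e₁₂ e₂₁ ∘ₗ extGauge k he hpq q

theorem isDoubleDerivation_extGauge (s : I) :
    IsDoubleDerivation (extBase k he hpq) (extGauge k he hpq s) :=
  Amalgam.isDoubleDerivation_pushDer _ _

theorem isDoubleDerivation_conjGauge :
    IsDoubleDerivation (extBase k he hpq) (conjGauge k he hpq) :=
  (isDoubleDerivation_extGauge he hpq q).innerMul_comp _ _

theorem extGauge_toExt (s : I) (a : A) : extGauge k he hpq s (ι a) = gauge k (ι (e s)) (ι a) := by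
  rw [extGauge, toExt, Amalgam.pushDer_inl, gauge_apply, gauge_apply, map_sub,
    Amalgam.inlTensor_tmul, Amalgam.inlTensor_tmul, map_mul, map_mul]

theorem conjGauge_toExt (a : A) :
    conjGauge k he hpq (ι a) = innerDer (e₂₁ ⊗ₜ[k] e₁₂) (ι a) := by
  rw [conjGauge, LinearMap.comp_apply, extGauge_toExt, gauge_apply, map_sub, innerMul_tmul,
    innerMul_tmul, mul_assoc, toExt_mul_unit21, ← mul_assoc e₁₂, unit12_mul_toExt, innerDer_tmul]

theorem innerMul_extGauge (s : I) (x : ExtAlgebra k he hpq) :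
    innerMul (ι (e s)) (ι (e s)) (extGauge k he hpq s x) = extGauge k he hpq s x := by
  have h := isDoubleDerivation_extGauge (k := k) he hpq s
  refine LinearMap.congr_fun (f := innerMul (ι (e s)) (ι (e s)) ∘ₗ extGauge k he hpq s)
    (Amalgam.doubleDerivation_ext (h.innerMul_comp _ _) h fun a => ?_) x
  have idem : ι (e s) * ι (e s) = ι (e s) := by rw [← map_mul, (he.idem s).eq]
  change innerMul _ _ (extGauge k he hpq s (ι a)) = extGauge k he hpq s (ι a)
  rw [extGauge_toExt, gauge_apply, map_sub, innerMul_tmul, innerMul_tmul, mul_assoc, idem,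
    ← mul_assoc, idem]

theorem extGauge_eq_gauge {s : I} (hp : s ≠ p) (hq : s ≠ q) :
    extGauge k he hpq s = gauge k (ι (e s)) := by
  have toExt_mul {t : I} (hts : s ≠ t) : ι (e s) * ι (e t) = 0 := by
    rw [← map_mul, he.ortho hts, map_zero]
  have mul_toExt {t : I} (hts : s ≠ t) : ι (e t) * ι (e s) = 0 := by
    rw [← map_mul, he.ortho hts.symm, map_zero]
  rw [gauge_eq_innerDer]
  refine Amalgam.doubleDerivation_eq_innerDer (isDoubleDerivation_extGauge he hpq s)
    (fun a => (extGauge_toExt he hpq s a).trans (by rw [gauge_eq_innerDer]; rfl)) fun m => ?_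
  refine (isDoubleDerivation_adjoin (innerDer_mul _) ?_).vanish _ (inr_mem_adjoin he hpq m)
  rintro _ (rfl | rfl)
  · rw [innerDer_tmul, ← unit21_mul_toExt, mul_assoc, mul_toExt hp, unit21_mul_toExt,
      ← toExt_mul_unit21, ← mul_assoc, toExt_mul hq]
    simp
  · rw [innerDer_tmul, ← toExt_mul_unit12, ← mul_assoc, toExt_mul hp, toExt_mul_unit12,
      ← unit12_mul_toExt, mul_assoc, mul_toExt hq]
    simp

theorem extGauge_add_conjGauge : extGauge k he hpq p + conjGauge k he hpq =
    innerDer (ι (e p) ⊗ₜ[k] ι (e p) + e₂₁ ⊗ₜ[k] e₁₂) := by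
  have h := isUnitPair (k := k) he hpq
  refine Amalgam.doubleDerivation_eq_innerDer
    ((isDoubleDerivation_extGauge he hpq p).add (isDoubleDerivation_conjGauge he hpq))
    (fun a => ?_) fun m => ?_
  · change extGauge k he hpq p (ι a) + conjGauge k he hpq (ι a) = innerDer _ (ι a)
    rw [extGauge_toExt, conjGauge_toExt, gauge_eq_innerDer, innerDer_add, LinearMap.add_apply]
  · refine (isDoubleDerivation_adjoin (innerDer_mul _) ?_).vanish _ (inr_mem_adjoin he hpq m)
    have vvu : e₁₂ * (e₁₂ * e₂₁) = 0 := by rw [← mul_assoc, h.vv, zero_mul]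
    rw [← unit12_mul_unit21]
    rintro _ (rfl | rfl) <;>
    simp [innerDer_apply, mul_add, add_mul, mul_assoc, h.uu, h.vv, h.uvu, h.vuv, vvu]

end ExtensionAlgebra

theorem isQuasiPoisson_iff {k : Type*} [Field k] {A : Type*} [Ring A] [Algebra k A] {I : Type*}
    [Fintype I] {e : I → A} (he : ∀ s, IsIdempotentElem (e s)) {br : A →ₗ[k] A →ₗ[k] A ⊗[k] A} :
    IsQuasiPoisson e br ↔ ∀ a b c, tripleBracket br a b c =
      (1 / 4 : k) • ∑ s, contract₃ k A (gauge k (e s) a) (gauge k (e s) b) (gauge k (e s) c) := by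
  simp only [IsQuasiPoisson, quasiPoisson_term_eq_contract₃ (he _)]

theorem sum_subtype_ne {I M : Type*} [Fintype I] [DecidableEq I] [AddCommGroup M] {p q : I}
    (hpq : p ≠ q) {f g : I → M} (hfg : ∀ s ≠ p, f s = g s) :
    ∑ s : {s : I // s ≠ q}, f s = ∑ s, g s + (f p - g p - g q) := by
  have sum_f : ∑ s : {s : I // s ≠ q}, f s = ∑ s, f s - f q := by
    rw [← Finset.sum_subtype (Finset.univ.erase q) (by simp) f,
      Finset.sum_erase_eq_sub (Finset.mem_univ q)]
  have sum_f_sub_g : ∑ s, (f s - g s) = f p - g p :=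
    Finset.sum_eq_single p (fun s _ hs => by rw [hfg s hs, sub_self]) (by simp)
  rw [sum_f, hfg q hpq.symm, ← sum_f_sub_g, Finset.sum_sub_distrib]
  abel

section ExtensionBracket

variable {k : Type*} [Field k] {A : Type*} [Ring A] [Algebra k A] {I : Type*} [Fintype I]
  {e : I → A} (he : CompleteOrthogonalIdempotents e) {p q : I} (hpq : p ≠ q)

local notation "e₁₂" => unit12 k he hpq
local notation "e₂₁" => unit21 k he hpq
local notation "ι" => toExt k he hpq

variable (k) in
/-- The double derivation of the extension algebra that restricts to the gauge element of `e_s`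
on the fusion algebra: `E_s` for `s ≠ p`, and `E_p + e₁₂ ∗ E_q ∗ e₂₁` for `s = p`. -/
def fusedGauge [DecidableEq I] (s : I) :
    ExtAlgebra k he hpq →ₗ[k] ExtAlgebra k he hpq ⊗[k] ExtAlgebra k he hpq :=
  extGauge k he hpq s + if s = p then conjGauge k he hpq else 0

theorem isDoubleDerivation_fusedGauge [DecidableEq I] (s : I) :
    IsDoubleDerivation (extBase k he hpq) (fusedGauge k he hpq s) := by
  by_cases hs : s = p
  · subst hs
    simpa only [fusedGauge, if_pos] using
      (isDoubleDerivation_extGauge he hpq s).add (isDoubleDerivation_conjGauge he hpq)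
  · simpa only [fusedGauge, if_neg hs, add_zero] using isDoubleDerivation_extGauge he hpq s

section Bracket

variable {br : A →ₗ[k] A →ₗ[k] A ⊗[k] A} (hbr : IsDoubleBracket (idemSubalgebra k e) br)

/-- The extension of a double bracket on `A` to the extension algebra. -/
abbrev extBracket : ExtAlgebra k he hpq →ₗ[k] ExtAlgebra k he hpq →ₗ[k]
    ExtAlgebra k he hpq ⊗[k] ExtAlgebra k he hpq :=
  Amalgam.pushBracket (j' := matMap k) (baseMap_mem he hpq) hbr

/-- The double bracket on the extension algebra that restricts to the fusion bracket on the fusion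
algebra. -/
def extFusionBracket : ExtAlgebra k he hpq →ₗ[k] ExtAlgebra k he hpq →ₗ[k]
    ExtAlgebra k he hpq ⊗[k] ExtAlgebra k he hpq :=
  extBracket he hpq hbr
    + (-(1 / 2 : k)) • bivectorBracket (extGauge k he hpq p) (conjGauge k he hpq)

theorem isDoubleBracket_bivectorBracket_extGauge : IsDoubleBracket (extBase k he hpq)
    (bivectorBracket (extGauge k he hpq p) (conjGauge k he hpq)) :=
  isDoubleBracket_bivectorBracket (isDoubleDerivation_extGauge he hpq p)
    (isDoubleDerivation_conjGauge he hpq)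

theorem isDoubleBracket_extFusionBracket :
    IsDoubleBracket (extBase k he hpq) (extFusionBracket he hpq hbr) :=
  (Amalgam.isDoubleBracket_pushBracket _ hbr).add
    ((isDoubleBracket_bivectorBracket_extGauge he hpq).smul _)

theorem bivectorBracket_extGauge_toExt (a b : A) :
    bivectorBracket (extGauge k he hpq p) (conjGauge k he hpq) (ι a) (ι b) =
      wedgeBracket k e₂₁ e₁₂ (ι a) (ι b) := by
  rw [← (isUnitPair he hpq).bivectorBracket_innerDer, bivectorBracket_apply, bivectorBracket_apply]
  simp only [extGauge_toExt, conjGauge_toExt, unit12_mul_unit21, gauge_eq_innerDer]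

theorem extBracket_toExt (a b : A) : extBracket he hpq hbr (ι a) (ι b) =
    TensorProduct.map (ι).toLinearMap (ι).toLinearMap (br a b) :=
  Amalgam.pushBracket_inl_inl _ hbr a b

theorem tripleBracket_extBracket_toExt (hqP : IsQuasiPoisson e br) (a b c : A) :
    tripleBracket (extBracket he hpq hbr) (ι a) (ι b) (ι c) =
      (1 / 4 : k) • ∑ s, contract₃ k _ (gauge k (ι (e s)) (ι a)) (gauge k (ι (e s)) (ι b))
        (gauge k (ι (e s)) (ι c)) := by
  have h := map_tripleBracket (fun a b => (extBracket_toExt he hpq hbr a b).symm) a b c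
  rw [(isQuasiPoisson_iff he.idem).1 hqP, map_smul, map_sum] at h
  simp only [map_contract₃ (f := (ι).toLinearMap) (map_mul ι),
    map_gauge (f := (ι).toLinearMap) (map_mul ι)] at h
  exact h.symm

theorem tripleBracket_extFusionBracket_toExt [DecidableEq I] (hqP : IsQuasiPoisson e br)
    (a b c : A) : tripleBracket (extFusionBracket he hpq hbr) (ι a) (ι b) (ι c) =
      (1 / 4 : k) • ∑ s : {s : I // s ≠ q}, contract₃ k _ (fusedGauge k he hpq s (ι a))
        (fusedGauge k he hpq s (ι b)) (fusedGauge k he hpq s (ι c)) := by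
  rw [sum_subtype_ne hpq (f := fun s => contract₃ k _ (fusedGauge k he hpq s (ι a))
      (fusedGauge k he hpq s (ι b)) (fusedGauge k he hpq s (ι c)))
    (g := fun s => contract₃ k _ (gauge k (ι (e s)) (ι a)) (gauge k (ι (e s)) (ι b))
      (gauge k (ι (e s)) (ι c)))
    fun s hs => by simp only [fusedGauge, if_neg hs, add_zero, extGauge_toExt]]
  have half_mul_half : (-(1 / 2) : k) * -(1 / 2) = 1 / 4 := by
    rw [neg_mul_neg, div_mul_div_comm]
    norm_num
  have h : tripleBracket (extFusionBracket he hpq hbr) (ι a) (ι b) (ι c) = _ :=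
    (isUnitPair he hpq).tripleBracket_add_smul (Amalgam.isDoubleBracket_pushBracket _ hbr)
      (isDoubleBracket_bivectorBracket_extGauge he hpq) (unit21_mem_extBase he hpq)
      (unit12_mem_extBase he hpq) (ι).toLinearMap (extBracket_toExt he hpq hbr)
      (bivectorBracket_extGauge_toExt he hpq) (-(1 / 2)) a b c
  rw [smul_add]
  refine h.trans (congrArg₂ (· + ·) (tripleBracket_extBracket_toExt he hpq hbr hqP a b c) ?_)
  simp only [half_mul_half, fusedGauge, if_pos, extGauge_add_conjGauge, unit12_mul_unit21,
    unit21_mul_unit12, AlgHom.toLinearMap_apply]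

theorem tripleBracket_extFusionBracket [DecidableEq I] (hqP : IsQuasiPoisson e br)
    (x y z : ExtAlgebra k he hpq) : tripleBracket (extFusionBracket he hpq hbr) x y z =
      (1 / 4 : k) • ∑ s : {s : I // s ≠ q}, contract₃ k _ (fusedGauge k he hpq s x)
        (fusedGauge k he hpq s y) (fusedGauge k he hpq s z) :=
  Amalgam.cyclicTriderivation_ext
    (isDoubleBracket_extFusionBracket he hpq hbr).isCyclicTriderivation
    (IsCyclicTriderivation.smul_sum (J := {s : I // s ≠ q})
      (fun s => (isDoubleDerivation_fusedGauge he hpq s.1).isCyclicTriderivation) (1 / 4))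
    (tripleBracket_extFusionBracket_toExt he hpq hbr hqP) x y z

end Bracket

end ExtensionBracket

/-! ### Restriction to the fusion algebra -/

section Corner

variable {k : Type*} [Field k] {R : Type*} [Ring R] [Algebra k R] {x : R}
  (hx : IsIdempotentElem x)

theorem cornerVal_mul (a b : hx.Corner) :
    cornerVal (k := k) hx (a * b) = cornerVal (k := k) hx a * cornerVal (k := k) hx b := rfl

theorem cornerVal_cornerProj (a : R) :
    cornerVal (k := k) hx (cornerProj (k := k) hx a) = x * a * x := rfl

theorem cornerVal_injective : Function.Injective (cornerVal (k := k) hx) :=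
  fun _ _ h => Subtype.ext h

theorem mul_cornerVal (a : hx.Corner) :
    x * cornerVal (k := k) hx a = cornerVal (k := k) hx a :=
  ((Subsemigroup.mem_corner_iff hx).1 a.2).1

theorem cornerVal_mul_self (a : hx.Corner) :
    cornerVal (k := k) hx a * x = cornerVal (k := k) hx a :=
  ((Subsemigroup.mem_corner_iff hx).1 a.2).2

theorem map_cornerVal_injective :
    Function.Injective (TensorProduct.map (cornerVal (k := k) hx) (cornerVal (k := k) hx)) :=
  TensorProduct.map_injective_of_flat_flat _ _ (cornerVal_injective hx) (cornerVal_injective hx)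

theorem map_map_cornerVal_injective : Function.Injective (TensorProduct.map
    (TensorProduct.map (cornerVal (k := k) hx) (cornerVal (k := k) hx)) (cornerVal hx)) :=
  TensorProduct.map_injective_of_flat_flat _ _ (map_cornerVal_injective hx)
    (cornerVal_injective hx)

theorem map_cornerVal_map_cornerProj (w : R ⊗[k] R) :
    TensorProduct.map (cornerVal hx) (cornerVal hx)
      (TensorProduct.map (cornerProj hx) (cornerProj hx) w) =
        innerMul x x ((x ⊗ₜ[k] 1) * w * (1 ⊗ₜ[k] x)) := by
  induction w using TensorProduct.induction_on with
  | zero => simp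
  | add w w' h h' => simp only [map_add, mul_add, add_mul, h, h']
  | tmul b c => simp [innerMul_tmul, cornerVal_cornerProj, mul_assoc]

theorem IsDoubleDerivation.map_cornerVal_map_cornerProj {B : Subalgebra k R}
    {δ : R →ₗ[k] R ⊗[k] R} (hδ : IsDoubleDerivation B δ) (hxB : x ∈ B) (a : hx.Corner) :
    TensorProduct.map (cornerVal hx) (cornerVal hx)
      (TensorProduct.map (cornerProj hx) (cornerProj hx) (δ (cornerVal (k := k) hx a))) =
        innerMul x x (δ (cornerVal (k := k) hx a)) := by
  rw [DoubleBracket.map_cornerVal_map_cornerProj, ← hδ.mul_mul hxB hxB, mul_cornerVal,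
    cornerVal_mul_self]

theorem IsDoubleBracket.map_cornerVal_map_cornerProj {B : Subalgebra k R}
    {br : R →ₗ[k] R →ₗ[k] R ⊗[k] R} (h : IsDoubleBracket B br) (hxB : x ∈ B) (a b : hx.Corner) :
    TensorProduct.map (cornerVal hx) (cornerVal hx)
      (TensorProduct.map (cornerProj hx) (cornerProj hx)
        (br (cornerVal (k := k) hx a) (cornerVal (k := k) hx b))) =
        br (cornerVal (k := k) hx a) (cornerVal (k := k) hx b) := by
  rw [(h.isDoubleDerivation _).map_cornerVal_map_cornerProj hx hxB, ← h.mul_mul_left hxB hxB,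
    mul_cornerVal, cornerVal_mul_self]

theorem isDoubleBracket_corner {B : Subalgebra k R} {br : R →ₗ[k] R →ₗ[k] R ⊗[k] R}
    (hbr : IsDoubleBracket B br) {br' : hx.Corner →ₗ[k] hx.Corner →ₗ[k] hx.Corner ⊗[k] hx.Corner}
    (h : ∀ a b, TensorProduct.map (cornerVal hx) (cornerVal hx) (br' a b) =
      br (cornerVal (k := k) hx a) (cornerVal (k := k) hx b)) {S : Set hx.Corner}
    (hS : ∀ a ∈ S, cornerVal (k := k) hx a ∈ B) : IsDoubleBracket (Algebra.adjoin k S) br' := by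
  have map_injective := map_cornerVal_injective (k := k) hx
  refine isDoubleBracket_adjoin (fun a b => map_injective ?_) (fun a b c => map_injective ?_)
    (fun a ha b => map_injective ?_)
  · rw [map_neg, TensorProduct.map_comm, h, h, hbr.antisymm]
  · have map_mul_right (w : hx.Corner ⊗[k] hx.Corner) :
        TensorProduct.map (cornerVal (k := k) hx) (cornerVal hx) (w * (1 ⊗ₜ[k] c)) =
          TensorProduct.map (cornerVal (k := k) hx) (cornerVal hx) w *
            (1 ⊗ₜ[k] cornerVal (k := k) hx c) := by
      induction w using TensorProduct.induction_on with
      | zero => simp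
      | add w w' h h' => simp only [add_mul, map_add, h, h']
      | tmul y z => simp [cornerVal_mul]
    have map_mul_left (w : hx.Corner ⊗[k] hx.Corner) :
        TensorProduct.map (cornerVal (k := k) hx) (cornerVal hx) ((b ⊗ₜ[k] 1) * w) =
          (cornerVal (k := k) hx b ⊗ₜ[k] 1) *
            TensorProduct.map (cornerVal (k := k) hx) (cornerVal hx) w := by
      induction w using TensorProduct.induction_on with
      | zero => simp
      | add w w' h h' => simp only [mul_add, map_add, h, h']
      | tmul y z => simp [cornerVal_mul]
    rw [h, map_add, map_mul_right, map_mul_left, h, h, cornerVal_mul]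
    exact hbr.leibniz _ _ _
  · rw [h, map_zero]
    exact hbr.vanish_right _ (hS a ha) _

end Corner

section FusionAlgebra

variable {k : Type*} [Field k] {A : Type*} [Ring A] [Algebra k A] {I : Type*} [Fintype I]
  {e : I → A} (he : CompleteOrthogonalIdempotents e) {p q : I} (hpq : p ≠ q)

local notation "e₁₂" => unit12 k he hpq
local notation "e₂₁" => unit21 k he hpq
local notation "ε" => eps k he hpq
local notation "ι" => toExt k he hpq

variable (k) in
/-- The inclusion of the fusion algebra into the extension algebra. -/
abbrev fusionVal : FusionAlgebra k he hpq →ₗ[k] ExtAlgebra k he hpq :=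
  cornerVal (eps_idem k he hpq)

local notation "val" => fusionVal k he hpq

theorem fusionVal_cut (x : ExtAlgebra k he hpq) : val (cut k he hpq x) = ε * x * ε := rfl

theorem fusionVal_mul (a b : FusionAlgebra k he hpq) : val (a * b) = val a * val b := rfl

theorem eps_mem_extBase : ε ∈ extBase k he hpq := sub_mem (one_mem _) (toExt_mem_extBase he hpq q)

theorem eps_mul_toExt {s : I} (hs : s ≠ q) : ε * ι (e s) = ι (e s) := by
  rw [eps, sub_mul, one_mul, ← map_mul, he.ortho hs.symm, map_zero, sub_zero]

theorem toExt_mul_eps {s : I} (hs : s ≠ q) : ι (e s) * ε = ι (e s) := by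
  rw [eps, mul_sub, mul_one, ← map_mul, he.ortho hs, map_zero, sub_zero]

theorem eps_mul_toExt_self : ε * ι (e q) = 0 := by
  rw [eps, sub_mul, one_mul, ← map_mul, (he.idem q).eq, sub_self]

theorem toExt_self_mul_eps : ι (e q) * ε = 0 := by
  rw [eps, mul_sub, mul_one, ← map_mul, (he.idem q).eq, sub_self]

theorem pairwise_toExt_mul_toExt :
    Pairwise fun s t : {s : I // s ≠ q} => ι (e s) * ι (e t) = 0 :=
  (he.1.map (ι).toRingHom).ortho.comp_of_injective Subtype.val_injective

theorem sum_toExt_eq_eps [DecidableEq I] : ∑ s : {s : I // s ≠ q}, ι (e s) = ε := by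
  rw [eps, ← map_one ι, ← he.complete, Fintype.sum_eq_add_sum_subtype_ne e q, map_add, map_sum,
    add_sub_cancel_left]

theorem eps_mul_unit12 : ε * e₁₂ = e₁₂ := by
  rw [← toExt_mul_unit12, ← mul_assoc, eps_mul_toExt he hpq hpq]

theorem unit12_mul_eps : e₁₂ * ε = 0 := by
  rw [← unit12_mul_toExt, mul_assoc, toExt_self_mul_eps, mul_zero]

theorem eps_mul_unit21 : ε * e₂₁ = 0 := by
  rw [← toExt_mul_unit21, ← mul_assoc, eps_mul_toExt_self, zero_mul]

theorem unit21_mul_eps : e₂₁ * ε = e₂₁ := by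
  rw [← unit21_mul_toExt, mul_assoc, toExt_mul_eps he hpq hpq]

theorem fusionVal_mul_unit21 (a : FusionAlgebra k he hpq) : val a * e₂₁ = 0 := by
  rw [← cornerVal_mul_self, mul_assoc, eps_mul_unit21, mul_zero]

theorem unit12_mul_fusionVal (a : FusionAlgebra k he hpq) : e₁₂ * val a = 0 := by
  rw [← mul_cornerVal, ← mul_assoc, unit12_mul_eps, zero_mul]

theorem fusionVal_fusionIdem (s : {s : I // s ≠ q}) :
    val (fusionIdem k he hpq s) = ι (e s) := by
  rw [fusionIdem, fusionVal_cut, eps_mul_toExt he hpq s.2, toExt_mul_eps he hpq s.2]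

theorem completeOrthogonalIdempotents_fusionIdem [DecidableEq I] :
    CompleteOrthogonalIdempotents (fusionIdem k he hpq) where
  idem s := cornerVal_injective (k := k) _ (by
    rw [cornerVal_mul, fusionVal_fusionIdem, ← map_mul, (he.idem s).eq])
  ortho s t hst := cornerVal_injective (k := k) _ (by
    rw [cornerVal_mul, fusionVal_fusionIdem, fusionVal_fusionIdem,
      pairwise_toExt_mul_toExt he hpq hst, map_zero])
  complete := cornerVal_injective (k := k) _ (by
    simp only [map_sum, fusionVal_fusionIdem]
    exact sum_toExt_eq_eps he hpq)

theorem map_fusionVal_traceDer {D : Subalgebra k (ExtAlgebra k he hpq)} (hD : ε ∈ D)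
    {δ : ExtAlgebra k he hpq →ₗ[k] ExtAlgebra k he hpq ⊗[k] ExtAlgebra k he hpq}
    (hδ : IsDoubleDerivation D δ) (a : FusionAlgebra k he hpq) :
    TensorProduct.map val val (traceDer he hpq δ a) =
      innerMul ε ε (δ (val a)) + innerMul e₁₂ e₂₁ (δ (val a)) := by
  have traceDer_eq : traceDer he hpq δ a = TensorProduct.map (cut k he hpq) (cut k he hpq)
      ((δ + innerMul e₁₂ e₂₁ ∘ₗ δ) (val a)) := by
    rw [traceDer, TensorProduct.map_comp]
    exact (map_add (TensorProduct.map (cut k he hpq) (cut k he hpq)) _ _).symm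
  rw [traceDer_eq, cut,
    (hδ.add (hδ.innerMul_comp _ _)).map_cornerVal_map_cornerProj (eps_idem k he hpq) hD,
    LinearMap.add_apply, LinearMap.comp_apply, map_add, innerMul_innerMul, eps_mul_unit12,
    unit21_mul_eps]

theorem map_fusionVal_traceGauge_left (a : FusionAlgebra k he hpq) :
    TensorProduct.map val val (traceGauge k he hpq p a) = extGauge k he hpq p (val a) := by
  have unit12_mul_toExt_left : e₁₂ * ι (e p) = 0 := by
    rw [← eps_mul_toExt he hpq hpq, ← mul_assoc, unit12_mul_eps, zero_mul]
  refine (map_fusionVal_traceDer he hpq (eps_mem_extBase he hpq)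
    (isDoubleDerivation_extGauge he hpq p) a).trans ?_
  rw [← innerMul_extGauge, innerMul_innerMul, innerMul_innerMul, eps_mul_toExt he hpq hpq,
    toExt_mul_eps he hpq hpq, unit12_mul_toExt_left]
  simp [innerMul_apply]

theorem map_fusionVal_traceGauge_right (a : FusionAlgebra k he hpq) :
    TensorProduct.map val val (traceGauge k he hpq q a) = conjGauge k he hpq (val a) := by
  refine (map_fusionVal_traceDer he hpq (eps_mem_extBase he hpq)
    (isDoubleDerivation_extGauge he hpq q) a).trans ?_
  rw [conjGauge, LinearMap.comp_apply, add_eq_right, ← innerMul_extGauge, innerMul_innerMul,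
    eps_mul_toExt_self]
  simp [innerMul_apply]

theorem fusedGauge_fusionVal [DecidableEq I] {s : I} (hs : s ≠ q) (a : FusionAlgebra k he hpq) :
    fusedGauge k he hpq s (val a) = gauge k (ι (e s)) (val a) := by
  by_cases hp : s = p
  · have innerDer_fusionVal : innerDer (e₂₁ ⊗ₜ[k] e₁₂) (val a) = 0 := by
      rw [innerDer_tmul, fusionVal_mul_unit21, unit12_mul_fusionVal, TensorProduct.zero_tmul,
        TensorProduct.tmul_zero, sub_zero]
    rw [hp, fusedGauge, if_pos rfl, extGauge_add_conjGauge, innerDer_add, LinearMap.add_apply,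
      innerDer_fusionVal, add_zero, gauge_eq_innerDer]
  · rw [fusedGauge, if_neg hp, add_zero, extGauge_eq_gauge he hpq hp hs]

section Bracket

variable {br : A →ₗ[k] A →ₗ[k] A ⊗[k] A} (hbr : IsDoubleBracket (idemSubalgebra k e) br)

theorem map_fusionVal_fusionBracket (a b : FusionAlgebra k he hpq) :
    TensorProduct.map val val (fusionBracket he hpq hbr a b) =
      extFusionBracket he hpq hbr (val a) (val b) := by
  have map_inducedBracket : TensorProduct.map val val (inducedBracket he hpq hbr a b) =
      extBracket he hpq hbr (val a) (val b) :=
    (Amalgam.isDoubleBracket_pushBracket _ hbr).map_cornerVal_map_cornerProj (eps_idem k he hpq)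
      (eps_mem_extBase he hpq) a b
  rw [fusionBracket, bivectorBracket_smul, LinearMap.add_apply, LinearMap.add_apply, map_add,
    map_inducedBracket, extFusionBracket, LinearMap.add_apply, LinearMap.add_apply]
  simp only [LinearMap.smul_apply, bivectorBracket_apply, map_smul, map_sub,
    map_contract (f := val) (fusionVal_mul he hpq), map_fusionVal_traceGauge_left,
    map_fusionVal_traceGauge_right]

theorem isDoubleBracket_fusionBracket :
    IsDoubleBracket (idemSubalgebra k (fusionIdem k he hpq)) (fusionBracket he hpq hbr) := by
  refine isDoubleBracket_corner _ (isDoubleBracket_extFusionBracket he hpq hbr)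
    (map_fusionVal_fusionBracket he hpq hbr) ?_
  rintro _ ⟨s, rfl⟩
  exact (fusionVal_fusionIdem (k := k) he hpq s).symm ▸ toExt_mem_extBase he hpq s

theorem isQuasiPoisson_fusionBracket [DecidableEq I] (hqP : IsQuasiPoisson e br) :
    IsQuasiPoisson (fusionIdem k he hpq) (fusionBracket he hpq hbr) := by
  refine (isQuasiPoisson_iff (completeOrthogonalIdempotents_fusionIdem he hpq).idem).2
    fun a b c => map_map_cornerVal_injective (eps_idem k he hpq) ?_
  rw [map_tripleBracket (map_fusionVal_fusionBracket he hpq hbr),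
    tripleBracket_extFusionBracket he hpq hbr hqP, map_smul, map_sum]
  simp only [map_contract₃ (f := val) (fusionVal_mul he hpq),
    map_gauge (f := val) (fusionVal_mul he hpq), fusionVal_fusionIdem,
    fun s : {s : I // s ≠ q} => fusedGauge_fusionVal (k := k) he hpq s.2]

end Bracket

end FusionAlgebra

/-! ### Moment maps -/

section CornerInverse

variable {R : Type*} [Ring R] {x y a b a' b' u v : R}

theorem idem_mul_corner (hx : IsIdempotentElem x) (a : R) : x * (x * a * x) = x * a * x := by
  rw [← mul_assoc, ← mul_assoc, hx.eq]

theorem corner_mul_idem (hx : IsIdempotentElem x) (a : R) : x * a * x * x = x * a * x := by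
  rw [mul_assoc, hx.eq]

/-- The elements `a` and `b` of the corner `x R x` are inverse to each other. -/
structure IsCornerInverse (x a b : R) : Prop where
  mul_eq : a * b = x
  mul_eq' : b * a = x
  idem_mul : x * a = a
  idem_mul' : x * b = b

namespace IsCornerInverse

theorem symm (h : IsCornerInverse x a b) : IsCornerInverse x b a :=
  ⟨h.mul_eq', h.mul_eq, h.idem_mul', h.idem_mul⟩

theorem mul_idem (h : IsCornerInverse x a b) : a * x = a := by
  rw [← h.mul_eq', ← mul_assoc, h.mul_eq, h.idem_mul]

theorem mul (h : IsCornerInverse x a b) (h' : IsCornerInverse x a' b') :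
    IsCornerInverse x (a * a') (b' * b) where
  mul_eq := by rw [mul_assoc, ← mul_assoc a', h'.mul_eq, h.idem_mul', h.mul_eq]
  mul_eq' := by rw [mul_assoc, ← mul_assoc b, h.mul_eq', h'.idem_mul, h'.mul_eq']
  idem_mul := by rw [← mul_assoc, h.idem_mul]
  idem_mul' := by rw [← mul_assoc, h'.idem_mul']

theorem conj (h : IsCornerInverse x a b) (huv : u * v = x) (hvu : v * u = y) (hyv : y * v = v)
    (hvx : v * x = v) : IsCornerInverse y (v * a * u) (v * b * u) where
  mul_eq := by
    rw [mul_assoc, ← mul_assoc u, ← mul_assoc u, huv, h.idem_mul', ← mul_assoc, mul_assoc v,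
      h.mul_eq, hvx, hvu]
  mul_eq' := by
    rw [mul_assoc, ← mul_assoc u, ← mul_assoc u, huv, h.idem_mul, ← mul_assoc, mul_assoc v,
      h.mul_eq', hvx, hvu]
  idem_mul := by rw [← mul_assoc, ← mul_assoc, hyv]
  idem_mul' := by rw [← mul_assoc, ← mul_assoc, hyv]

theorem map {S F : Type*} [Ring S] [FunLike F R S] [MulHomClass F R S]
    (h : IsCornerInverse x a b) (f : F) : IsCornerInverse (f x) (f a) (f b) where
  mul_eq := by rw [← map_mul, h.mul_eq]
  mul_eq' := by rw [← map_mul, h.mul_eq']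
  idem_mul := by rw [← map_mul, h.idem_mul]
  idem_mul' := by rw [← map_mul, h.idem_mul']

theorem sum {J : Type*} [Fintype J] {e m n : J → R} (he : Pairwise (e · * e · = 0))
    (h : ∀ s, IsCornerInverse (e s) (m s) (n s)) :
    IsCornerInverse (∑ s, e s) (∑ s, m s) (∑ s, n s) := by
  have sum_mul_sum {f g : J → R} (hf : ∀ s, f s * e s = f s) (hg : ∀ s, e s * g s = g s) :
      (∑ s, f s) * ∑ s, g s = ∑ s, f s * g s := by
    rw [Finset.sum_mul_sum]
    refine Finset.sum_congr rfl fun s _ => Finset.sum_eq_single s (fun t _ hts => ?_) (by simp)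
    rw [← hf s, ← hg t, mul_assoc, ← mul_assoc (e s), he hts.symm, zero_mul, mul_zero]
  have idem (s : J) : e s * e s = e s := by
    nth_rw 2 [← (h s).mul_eq]
    rw [← mul_assoc, (h s).idem_mul, (h s).mul_eq]
  constructor
  · simp only [sum_mul_sum (fun s => (h s).mul_idem) (fun s => (h s).idem_mul'), (h _).mul_eq]
  · simp only [sum_mul_sum (fun s => (h s).symm.mul_idem) (fun s => (h s).idem_mul), (h _).mul_eq']
  · simp only [sum_mul_sum idem (fun s => (h s).idem_mul), (h _).idem_mul]
  · simp only [sum_mul_sum idem (fun s => (h s).idem_mul'), (h _).idem_mul']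

theorem isUnit {k : Type*} [Field k] [Algebra k R] {hx : IsIdempotentElem x} {r : hx.Corner}
    (h : IsCornerInverse x (cornerVal (k := k) hx r) b) : IsUnit r := by
  have val_proj : cornerVal (k := k) hx (cornerProj (k := k) hx b) = b := by
    rw [cornerVal_cornerProj, h.idem_mul', h.symm.mul_idem]
  refine ⟨⟨r, cornerProj (k := k) hx b, cornerVal_injective (k := k) hx ?_,
    cornerVal_injective (k := k) hx ?_⟩, rfl⟩
  · rw [cornerVal_mul, val_proj, h.mul_eq]; rfl
  · rw [cornerVal_mul, val_proj, h.mul_eq']; rfl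

end IsCornerInverse

theorem isCornerInverse_of_commute (hx : IsIdempotentElem x) {U : Rˣ} (hU : Commute x ↑U) :
    IsCornerInverse x (x * ↑U * x) (x * ↑U⁻¹ * x) := by
  have mul_mul_idem {w : R} (hw : Commute x w) : x * w * x = w * x := by
    rw [hw.eq, mul_assoc, hx.eq]
  have hU' : Commute x ↑U⁻¹ := hU.units_inv_right
  rw [mul_mul_idem hU, mul_mul_idem hU']
  constructor
  · rw [mul_assoc, ← mul_assoc x, mul_mul_idem hU', U.mul_inv_cancel_left]
  · rw [mul_assoc, ← mul_assoc x, mul_mul_idem hU, U.inv_mul_cancel_left]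
  · rw [← mul_assoc, mul_mul_idem hU]
  · rw [← mul_assoc, mul_mul_idem hU']

theorem commute_of_eq_sum {J : Type*} [Fintype J] {e : J → R} (he : OrthogonalIdempotents e)
    {Φ : R} (hΦ : Φ = ∑ s, e s * Φ * e s) (s : J) : Commute (e s) Φ := by
  have left : e s * Φ = e s * Φ * e s := by
    conv_lhs => rw [hΦ, Finset.mul_sum]
    rw [Finset.sum_eq_single s (fun t _ hts => ?_) (by simp), ← mul_assoc, ← mul_assoc,
      (he.idem s).eq]
    rw [mul_assoc (e t), ← mul_assoc, he.ortho hts.symm, zero_mul]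
  have right : Φ * e s = e s * Φ * e s := by
    conv_lhs => rw [hΦ, Finset.sum_mul]
    rw [Finset.sum_eq_single s (fun t _ hts => ?_) (by simp), mul_assoc, (he.idem s).eq]
    rw [mul_assoc, he.ortho hts, mul_zero]
  exact left.trans right.symm

theorem idem_mul_sum_mul_idem {J : Type*} [Fintype J] {e m : J → R}
    (he : Pairwise (e · * e · = 0)) (hl : ∀ s, e s * m s = m s)
    (hr : ∀ s, m s * e s = m s) (t : J) :
    e t * (∑ s, m s) * e t = m t := by
  rw [Finset.mul_sum, Finset.sum_eq_single t (fun s _ hst => ?_) (by simp), hl, hr]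
  rw [← hl s, ← mul_assoc, he hst.symm, zero_mul]

end CornerInverse

section MomentFor

variable {k : Type*} [Field k] {R : Type*} [Ring R] [Algebra k R] {B : Subalgebra k R}
  {br : R →ₗ[k] R →ₗ[k] R ⊗[k] R} {t : k} {δ : R →ₗ[k] R ⊗[k] R}

theorem innerMul_gauge_add_innerMul_gauge {x y : R} (hxy : x * y = y) (hyx : y * x = y) (a : R) :
    innerMul y 1 (gauge k x a) + innerMul 1 y (gauge k x a) =
      (a * x) ⊗ₜ[k] y - x ⊗ₜ[k] (y * a) + (a * y) ⊗ₜ[k] x - y ⊗ₜ[k] (x * a) := by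
  rw [gauge_apply, map_sub, map_sub, innerMul_tmul, innerMul_tmul, innerMul_tmul, innerMul_tmul,
    ← mul_assoc y, mul_assoc a x y, hxy, hyx]
  simp only [mul_one, one_mul, add_sub_assoc]

theorem IsMomentFor.conj (h : IsDoubleBracket B br) {u v y : R} (hu : u ∈ B) (hv : v ∈ B)
    (hy : IsMomentFor br t δ y) (huvy : u * v * y = y) (hyuv : y * (u * v) = y) :
    IsMomentFor br t (innerMul v u ∘ₗ δ) (v * y * u) := by
  intro a
  rw [h.mul_mul_left hv hu, hy, map_smul, map_add, LinearMap.comp_apply]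
  simp only [innerMul_innerMul, one_mul, mul_one, mul_assoc]
  rw [hyuv, ← mul_assoc v y, ← mul_assoc u (v * y), ← mul_assoc u v, huvy]

end MomentFor

section FusionMoment

variable {k : Type*} [Field k] {A : Type*} [Ring A] [Algebra k A] {I : Type*} [Fintype I]
  {e : I → A} (he : CompleteOrthogonalIdempotents e) {p q : I} (hpq : p ≠ q)

local notation "e₁₂" => unit12 k he hpq
local notation "e₂₁" => unit21 k he hpq
local notation "ε" => eps k he hpq
local notation "ι" => toExt k he hpq
local notation "val" => fusionVal k he hpq

variable (k) in
/-- The image `e₁₂ Φ_q e₂₁` of `Φ_q = e_q Φ e_q` under the trace map. -/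
abbrev conjMoment (Φ : A) : ExtAlgebra k he hpq := e₁₂ * ι (e q * Φ * e q) * e₂₁

variable (k) in
/-- The component at `e_s` of the moment map of the fusion algebra: the image of `Φ_s = e_s Φ e_s`
for `s ≠ p`, and the product of `Φ_p` with the conjugate `e₁₂ Φ_q e₂₁` of `Φ_q` for `s = p`. -/
def fusedMoment [DecidableEq I] (Φ : A) (s : I) : ExtAlgebra k he hpq :=
  if s = p then ι (e p * Φ * e p) * conjMoment k he hpq Φ else ι (e s * Φ * e s)

theorem extGauge_toExt_corner_of_ne {s t : I} (hst : s ≠ t) (Φ : A) :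
    extGauge k he hpq s (ι (e t * Φ * e t)) = 0 := by
  rw [extGauge_toExt, gauge_apply, ← map_mul, ← map_mul, mul_assoc, he.ortho hst.symm, ← mul_assoc,
    ← mul_assoc, he.ortho hst]
  simp

theorem extGauge_toExt_corner_self (s : I) (Φ : A) :
    extGauge k he hpq s (ι (e s * Φ * e s)) =
      ι (e s * Φ * e s) ⊗ₜ[k] ι (e s) - ι (e s) ⊗ₜ[k] ι (e s * Φ * e s) := by
  rw [extGauge_toExt, gauge_apply, ← map_mul, ← map_mul, corner_mul_idem (he.idem s),
    idem_mul_corner (he.idem s)]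

theorem extGauge_conjMoment (Φ : A) : extGauge k he hpq p (conjMoment k he hpq Φ) = 0 := by
  rw [(isDoubleDerivation_extGauge he hpq p).mul_mul (unit12_mem_extBase he hpq)
    (unit21_mem_extBase he hpq), extGauge_toExt_corner_of_ne he hpq hpq, mul_zero, zero_mul]

theorem conjGauge_toExt_corner_of_ne {s : I} (hs : s ≠ q) (Φ : A) :
    conjGauge k he hpq (ι (e s * Φ * e s)) = 0 := by
  rw [conjGauge, LinearMap.comp_apply, extGauge_toExt_corner_of_ne he hpq hs.symm, map_zero]

theorem conjGauge_conjMoment (Φ : A) : conjGauge k he hpq (conjMoment k he hpq Φ) =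
    conjMoment k he hpq Φ ⊗ₜ[k] ι (e p) - ι (e p) ⊗ₜ[k] conjMoment k he hpq Φ := by
  rw [conjGauge, LinearMap.comp_apply, (isDoubleDerivation_extGauge he hpq q).mul_mul
    (unit12_mem_extBase he hpq) (unit21_mem_extBase he hpq), extGauge_toExt_corner_self]
  simp only [mul_sub, sub_mul, Algebra.TensorProduct.tmul_mul_tmul, one_mul, mul_one, map_sub,
    innerMul_tmul, toExt_mul_unit21, unit12_mul_toExt, unit12_mul_unit21, ← mul_assoc]

theorem idem_mul_fusedMoment [DecidableEq I] (Φ : A) (s : I) :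
    ι (e s) * fusedMoment k he hpq Φ s = fusedMoment k he hpq Φ s := by
  by_cases hp : s = p
  · rw [hp, fusedMoment, if_pos rfl, ← mul_assoc, ← map_mul, idem_mul_corner (he.idem p)]
  · rw [fusedMoment, if_neg hp, ← map_mul, idem_mul_corner (he.idem s)]

theorem fusedMoment_mul_idem [DecidableEq I] (Φ : A) (s : I) :
    fusedMoment k he hpq Φ s * ι (e s) = fusedMoment k he hpq Φ s := by
  by_cases hp : s = p
  · rw [hp, fusedMoment, if_pos rfl, mul_assoc, mul_assoc _ e₂₁, unit21_mul_toExt]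
  · rw [fusedMoment, if_neg hp, ← map_mul, corner_mul_idem (he.idem s)]

theorem fusionVal_trace (a : A) : val (trace k he hpq a) = ε * ι a * ε + e₁₂ * ι a * e₂₁ := by
  rw [trace, map_add, fusionVal_cut, fusionVal_cut, ← mul_assoc, ← mul_assoc, eps_mul_unit12,
    mul_assoc _ e₂₁, unit21_mul_eps]

theorem fusionVal_trace_corner_of_ne {s : I} (hs : s ≠ q) (Φ : A) :
    val (trace k he hpq (e s * Φ * e s)) = ι (e s * Φ * e s) := by
  have unit12_mul_toExt_of_ne : e₁₂ * ι (e s) = 0 := by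
    rw [← unit12_mul_toExt, mul_assoc, ← map_mul, he.ortho hs.symm, map_zero, mul_zero]
  rw [fusionVal_trace, map_mul, map_mul, ← mul_assoc, ← mul_assoc, eps_mul_toExt he hpq hs,
    mul_assoc _ _ ε, toExt_mul_eps he hpq hs, ← mul_assoc, ← mul_assoc, unit12_mul_toExt_of_ne]
  simp only [zero_mul, add_zero]

theorem fusionVal_trace_corner_self (Φ : A) :
    val (trace k he hpq (e q * Φ * e q)) = conjMoment k he hpq Φ := by
  rw [fusionVal_trace, add_eq_right, map_mul, map_mul, ← mul_assoc, ← mul_assoc, eps_mul_toExt_self]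
  simp only [zero_mul]

theorem fusionVal_fusionMomentMap [DecidableEq I] (Φ : A) :
    val (fusionMomentMap k he hpq Φ) = ∑ s : {s : I // s ≠ q}, fusedMoment k he hpq Φ s := by
  have component_p : val (fusionIdem k he hpq ⟨p, hpq⟩ * trace k he hpq (e p * Φ * e p)
      * trace k he hpq (e q * Φ * e q) * fusionIdem k he hpq ⟨p, hpq⟩) =
      fusedMoment k he hpq Φ p := by
    rw [← fusedMoment_mul_idem, ← idem_mul_fusedMoment, fusedMoment, if_pos rfl, ← mul_assoc]
    simp only [fusionVal_mul, fusionVal_fusionIdem, fusionVal_trace_corner_of_ne he hpq hpq,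
      fusionVal_trace_corner_self]
  have component_of_ne {s : {s : I // s ≠ q}} (hs : s.1 ≠ p) : val (fusionIdem k he hpq s
      * trace k he hpq (e s * Φ * e s) * fusionIdem k he hpq s) = fusedMoment k he hpq Φ s := by
    rw [← fusedMoment_mul_idem, ← idem_mul_fusedMoment, fusedMoment, if_neg hs, fusionVal_mul,
      fusionVal_mul, fusionVal_fusionIdem, fusionVal_trace_corner_of_ne he hpq s.2]
  have sum_p : ∑ s : {s : I // s ≠ q}, (if s.1 = p then fusedMoment k he hpq Φ s else 0) =
      fusedMoment k he hpq Φ p := by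
    rw [Fintype.sum_eq_single ⟨p, hpq⟩ fun s hs => if_neg fun h => hs (Subtype.ext h), if_pos rfl]
  rw [fusionMomentMap, map_add, map_sum, component_p, ← sum_p, ← Finset.sum_add_distrib]
  refine Finset.sum_congr rfl fun s _ => ?_
  split_ifs with hs
  · rw [map_zero, add_zero]
  · rw [component_of_ne hs, zero_add]

/-- A diagonal unit commutes with the idempotents, so each of its components is invertible in its
corner, and so are their conjugates and products. -/
theorem exists_isCornerInverse_fusedMoment [DecidableEq I] {U : Aˣ}
    (hU : (U : A) = ∑ s, e s * U * e s) (s : I) :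
    ∃ n, IsCornerInverse (ι (e s)) (fusedMoment k he hpq U s) n := by
  have component (t : I) : ∃ n, IsCornerInverse (ι (e t)) (ι (e t * U * e t)) n :=
    ⟨_, (isCornerInverse_of_commute (he.idem t) (commute_of_eq_sum he.1 hU t)).map ι⟩
  by_cases hp : s = p
  · obtain ⟨n, hn⟩ := component p
    obtain ⟨m, hm⟩ := component q
    have conj := hm.conj (unit21_mul_unit12 he hpq) (unit12_mul_unit21 he hpq)
      (toExt_mul_unit12 he hpq) (unit12_mul_toExt he hpq)
    rw [hp, fusedMoment, if_pos rfl]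
    exact ⟨_, hn.mul conj⟩
  · rw [fusedMoment, if_neg hp]
    exact component s

theorem isUnit_fusionMomentMap [DecidableEq I] {Φ : A} (hU : IsUnit Φ)
    (hΦ : Φ = ∑ s, e s * Φ * e s) :
    IsUnit (fusionMomentMap k he hpq Φ) := by
  obtain ⟨U, rfl⟩ := hU
  choose n hn using exists_isCornerInverse_fusedMoment (k := k) he hpq hΦ
  have inverse := IsCornerInverse.sum (pairwise_toExt_mul_toExt he hpq) fun s => hn s
  rw [sum_toExt_eq_eps, ← fusionVal_fusionMomentMap] at inverse
  exact inverse.isUnit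

theorem fusionVal_fusionIdem_mul_fusionMomentMap [DecidableEq I] {Φ : A} (s : {s : I // s ≠ q}) :
    val (fusionIdem k he hpq s * fusionMomentMap k he hpq Φ * fusionIdem k he hpq s) =
      fusedMoment k he hpq Φ s := by
  rw [fusionVal_mul, fusionVal_mul, fusionVal_fusionIdem, fusionVal_fusionMomentMap]
  exact idem_mul_sum_mul_idem (pairwise_toExt_mul_toExt he hpq)
    (fun s => idem_mul_fusedMoment he hpq Φ s) (fun s => fusedMoment_mul_idem he hpq Φ s) s

section Bracket

variable {br : A →ₗ[k] A →ₗ[k] A ⊗[k] A} (hbr : IsDoubleBracket (idemSubalgebra k e) br) {Φ : A}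

theorem isMomentFor_extBracket (hΦ : IsMomentMap e br Φ) (s : I) :
    IsMomentFor (extBracket he hpq hbr) (1 / 2) (extGauge k he hpq s) (ι (e s * Φ * e s)) := by
  set y := ι (e s * Φ * e s)
  have hδ := isDoubleDerivation_extGauge (k := k) he hpq s
  refine LinearMap.congr_fun (Amalgam.doubleDerivation_ext
    (δ' := (1 / 2 : k) •
      (innerMul y 1 ∘ₗ extGauge k he hpq s + innerMul 1 y ∘ₗ extGauge k he hpq s))
    ((Amalgam.isDoubleBracket_pushBracket _ hbr).isDoubleDerivation y)
    (((hδ.innerMul_comp _ _).add (hδ.innerMul_comp _ _)).smul _) fun a => ?_)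
  have left : e s * (e s * Φ * e s) = e s * Φ * e s := idem_mul_corner (he.idem s) Φ
  have right : e s * Φ * e s * e s = e s * Φ * e s := corner_mul_idem (he.idem s) Φ
  change extBracket he hpq hbr (ι _) (ι a) = (1 / 2 : k) • (innerMul y 1 (extGauge k he hpq s (ι a))
    + innerMul 1 y (extGauge k he hpq s (ι a)))
  rw [extBracket_toExt, hΦ.moment, extGauge_toExt, innerMul_gauge_add_innerMul_gauge
    (by rw [← map_mul, left]) (by rw [← map_mul, right])]
  simp [y]

theorem isMomentFor_conjMoment (hΦ : IsMomentMap e br Φ) : IsMomentFor (extBracket he hpq hbr)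
    (1 / 2) (conjGauge k he hpq) (conjMoment k he hpq Φ) := by
  refine (isMomentFor_extBracket he hpq hbr hΦ q).conj (Amalgam.isDoubleBracket_pushBracket _ hbr)
    (unit21_mem_extBase he hpq) (unit12_mem_extBase he hpq) ?_ ?_
  · rw [unit21_mul_unit12, ← map_mul, idem_mul_corner (he.idem q)]
  · rw [unit21_mul_unit12, ← map_mul, corner_mul_idem (he.idem q)]

theorem isMomentFor_fusedMoment_self [DecidableEq I] (hΦ : IsMomentMap e br Φ) :
    IsMomentFor (extFusionBracket he hpq hbr) (1 / 2) (fusedGauge k he hpq p)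
      (fusedMoment k he hpq Φ p) := by
  rw [fusedGauge, fusedMoment, if_pos rfl, if_pos rfl]
  refine (isMomentFor_extBracket he hpq hbr hΦ p).mul (e := ι (e p))
    (Amalgam.isDoubleBracket_pushBracket _ hbr) (isMomentFor_conjMoment he hpq hbr hΦ) ?_ ?_
    (fun x => ?_) (fun x => ?_)
  · rw [(isDoubleDerivation_extGauge he hpq p).leibniz, extGauge_conjMoment,
      extGauge_toExt_corner_self]
    simp only [mul_zero, zero_add, sub_mul, Algebra.TensorProduct.tmul_mul_tmul, mul_one,
      ← mul_assoc, toExt_mul_unit12]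
  · rw [(isDoubleDerivation_conjGauge he hpq).leibniz, conjGauge_conjMoment,
      conjGauge_toExt_corner_of_ne he hpq hpq]
    simp only [zero_mul, add_zero, mul_sub, Algebra.TensorProduct.tmul_mul_tmul, one_mul, ← map_mul,
      corner_mul_idem (he.idem p)]
  · rw [← innerMul_extGauge, innerMul_innerMul, one_mul, ← map_mul, (he.idem p).eq]
  · rw [conjGauge, LinearMap.comp_apply, innerMul_innerMul, toExt_mul_unit12, mul_one]

theorem isMomentFor_fusedMoment [DecidableEq I] (hΦ : IsMomentMap e br Φ) {s : I} (hs : s ≠ q) :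
    IsMomentFor (extFusionBracket he hpq hbr) (1 / 2) (fusedGauge k he hpq s)
      (fusedMoment k he hpq Φ s) := by
  by_cases hp : s = p
  · exact hp ▸ isMomentFor_fusedMoment_self he hpq hbr hΦ
  · intro a
    have bivectorBracket_eq_zero :
        bivectorBracket (extGauge k he hpq p) (conjGauge k he hpq) (ι (e s * Φ * e s)) a = 0 := by
      rw [bivectorBracket_apply, extGauge_toExt_corner_of_ne he hpq (Ne.symm hp),
        conjGauge_toExt_corner_of_ne he hpq hs]
      simp only [map_zero, LinearMap.zero_apply, sub_zero]
    rw [fusedGauge, fusedMoment, if_neg hp, if_neg hp, add_zero,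
      ← isMomentFor_extBracket he hpq hbr hΦ s a]
    simp only [extFusionBracket, LinearMap.add_apply, LinearMap.smul_apply, bivectorBracket_eq_zero,
      smul_zero, add_zero]

theorem isMomentMap_fusionMomentMap [DecidableEq I] (hΦ : IsMomentMap e br Φ) :
    IsMomentMap (fusionIdem k he hpq) (fusionBracket he hpq hbr) (fusionMomentMap k he hpq Φ) where
  isUnit := isUnit_fusionMomentMap he hpq hΦ.isUnit hΦ.diagonal
  diagonal := cornerVal_injective (k := k) (eps_idem k he hpq) (by
    simp only [map_sum, fusionVal_fusionIdem_mul_fusionMomentMap, fusionVal_fusionMomentMap])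
  moment s a := map_cornerVal_injective (eps_idem k he hpq) (by
    rw [map_fusionVal_fusionBracket, fusionVal_fusionIdem_mul_fusionMomentMap,
      isMomentFor_fusedMoment he hpq hbr hΦ s.2, fusedGauge_fusionVal he hpq s.2,
      innerMul_gauge_add_innerMul_gauge (idem_mul_fusedMoment he hpq Φ s)
        (fusedMoment_mul_idem he hpq Φ s)]
    rw [← fusionVal_fusionIdem_mul_fusionMomentMap he hpq s, ← fusionVal_fusionIdem he hpq s]
    rfl)

end Bracket

end FusionMoment

/-! ### Finite generation -/

section FiniteType

variable {k : Type*} [Field k] {R : Type*} [Ring R] [Algebra k R] {x : R}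
  {J : Type*} [Fintype J] {a b : J → R}

theorem cornerProj_cornerVal (hx : IsIdempotentElem x) (v : hx.Corner) :
    cornerProj (k := k) hx (cornerVal (k := k) hx v) = v :=
  cornerVal_injective (k := k) hx <| by
    rw [cornerVal_cornerProj, mul_cornerVal, cornerVal_mul_self]

theorem cornerProj_mul_of_sum_eq_one (hx : IsIdempotentElem x) (hab : ∑ l, a l * x * b l = 1)
    (u v : R) : cornerProj (k := k) hx (u * v) =
      ∑ l, cornerProj (k := k) hx (u * a l) * cornerProj (k := k) hx (b l * v) := by
  refine cornerVal_injective (k := k) hx ?_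
  have expand (l : J) : x * (u * a l) * x * (x * (b l * v) * x) =
      x * u * (a l * x * b l) * (v * x) := by
    simp only [mul_assoc, ← mul_assoc x x, hx.eq]
  simp only [map_sum, cornerVal_mul, cornerVal_cornerProj, expand]
  rw [← Finset.sum_mul, ← Finset.mul_sum, hab, mul_one, mul_assoc, mul_assoc, mul_assoc]

theorem corner_eq_sum {hx : IsIdempotentElem x} (hab : ∑ l, a l * x * b l = 1) (v : hx.Corner) :
    v = ∑ i, cornerProj (k := k) hx (a i) *
      ∑ j, cornerProj (k := k) hx (b i * cornerVal (k := k) hx v * a j) *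
        cornerProj (k := k) hx (b j) := by
  set w := cornerVal (k := k) hx v with hw
  calc v = cornerProj (k := k) hx (1 * w) := by rw [one_mul, hw, cornerProj_cornerVal]
    _ = ∑ i, cornerProj (k := k) hx (a i) * cornerProj (k := k) hx (b i * w * 1) := by
      rw [cornerProj_mul_of_sum_eq_one hx hab]
      simp only [one_mul, mul_one]
    _ = _ := by
      refine Finset.sum_congr rfl fun i _ => congrArg _ ?_
      rw [cornerProj_mul_of_sum_eq_one hx hab]
      simp only [mul_one]

theorem cornerProj_mul_mul_mem_of_mem_adjoin {hx : IsIdempotentElem x}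
    (hab : ∑ l, a l * x * b l = 1) {C : Subalgebra k hx.Corner} {S : Set R}
    (one_mem : ∀ i j, cornerProj (k := k) hx (b i * a j) ∈ C)
    (mem : ∀ r ∈ S, ∀ i j, cornerProj (k := k) hx (b i * r * a j) ∈ C)
    {r : R} (hr : r ∈ Algebra.adjoin k S) (i j : J) :
    cornerProj (k := k) hx (b i * r * a j) ∈ C := by
  induction hr using Algebra.adjoin_induction generalizing i j with
  | mem r hr => exact mem r hr i j
  | algebraMap c =>
    rw [Algebra.algebraMap_eq_smul_one, mul_smul_comm, mul_one, smul_mul_assoc, map_smul]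
    exact C.smul_mem (one_mem i j) c
  | add r s _ _ hr hs =>
    rw [mul_add, add_mul, map_add]
    exact add_mem (hr i j) (hs i j)
  | mul r s _ _ hr hs =>
    rw [← mul_assoc, mul_assoc, cornerProj_mul_of_sum_eq_one hx hab]
    refine sum_mem fun l _ => mul_mem (hr i l) ?_
    rw [← mul_assoc]
    exact hs l j

theorem finiteType_corner (hx : IsIdempotentElem x) (hab : ∑ l, a l * x * b l = 1)
    (hR : Algebra.FiniteType k R) : Algebra.FiniteType k hx.Corner := by
  obtain ⟨S, hS⟩ := hR.out
  let proj (r : R) : hx.Corner := cornerProj (k := k) hx r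
  let middle (i j : J) : Set hx.Corner := (fun r => proj (b i * r * a j)) '' insert 1 (S : Set R)
  let generators : Set hx.Corner :=
    Set.range (fun i => proj (a i)) ∪ Set.range (fun j => proj (b j)) ∪ ⋃ i, ⋃ j, middle i j
  have finite : generators.Finite :=
    ((Set.finite_range _).union (Set.finite_range _)).union <|
      Set.finite_iUnion fun i => Set.finite_iUnion fun j => (S.finite_toSet.insert 1).image _
  have middle_mem {r : R} (hr : r ∈ insert 1 (S : Set R)) (i j : J) :
      proj (b i * r * a j) ∈ Algebra.adjoin k generators :=
    Algebra.subset_adjoin (Or.inr (Set.mem_iUnion₂.2 ⟨i, j, r, hr, rfl⟩))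
  have mem (r : R) (i j : J) : proj (b i * r * a j) ∈ Algebra.adjoin k generators :=
    cornerProj_mul_mul_mem_of_mem_adjoin hab
      (fun i j => by simpa only [mul_one] using middle_mem (Set.mem_insert 1 _) i j)
      (fun r hr => middle_mem (Set.mem_insert_of_mem 1 hr)) (hS ▸ Algebra.mem_top) i j
  refine ⟨finite.toFinset, ?_⟩
  rw [Set.Finite.coe_toFinset, eq_top_iff]
  intro v _
  have v_eq : v = ∑ i, proj (a i) *
      ∑ j, proj (b i * cornerVal (k := k) hx v * a j) * proj (b j) :=
    corner_eq_sum hab v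
  rw [v_eq]
  exact sum_mem fun i _ =>
    mul_mem (Algebra.subset_adjoin (Or.inl (Or.inl ⟨i, rfl⟩))) <| sum_mem fun j _ =>
      mul_mem (mem _ i j) (Algebra.subset_adjoin (Or.inl (Or.inr ⟨j, rfl⟩)))

end FiniteType

section FusionFiniteType

variable {k : Type*} [Field k] {A : Type*} [Ring A] [Algebra k A] {I : Type*} [Fintype I]
  {e : I → A} (he : CompleteOrthogonalIdempotents e) {p q : I} (hpq : p ≠ q)

/-- `ε` is a full idempotent: `1 = ε + e_q = 1 * ε * 1 + e₂₁ * ε * e₁₂`. -/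
theorem finiteType_fusionAlgebra (hA : Algebra.FiniteType k A) :
    Algebra.FiniteType k (FusionAlgebra k he hpq) := by
  have full : ∑ l, ![1, unit21 k he hpq] l * eps k he hpq * ![1, unit12 k he hpq] l = 1 := by
    rw [Fin.sum_univ_two]
    change 1 * eps k he hpq * 1 + unit21 k he hpq * eps k he hpq * unit12 k he hpq = 1
    rw [one_mul, mul_one, unit21_mul_eps, unit21_mul_unit12, eps, sub_add_cancel]
  exact finiteType_corner (eps_idem k he hpq) full (Amalgam.finiteType hA inferInstance)

end FusionFiniteType

end

end DoubleBracket


theorem mainTheorem2_general {k : Type*} [Field k] [NeZero (2 : k)] {A : Type*} [Ring A]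
    [Algebra k A] {I : Type*} [Fintype I] [DecidableEq I] {e : I → A}
    {br : A →ₗ[k] A →ₗ[k] A ⊗[k] A} {Φ : A} (h : DoubleBracket.IsQuasiHamiltonian e br Φ)
    {p q : I} (hpq : p ≠ q) :
    DoubleBracket.IsQuasiHamiltonian (DoubleBracket.fusionIdem k h.idem hpq)
        (DoubleBracket.fusionBracket h.idem hpq h.bracket)
        (DoubleBracket.fusionMomentMap k h.idem hpq Φ) ∧
      (Algebra.FiniteType k A →
        Algebra.FiniteType k (DoubleBracket.FusionAlgebra k h.idem hpq)) :=
  ⟨{ idem := DoubleBracket.completeOrthogonalIdempotents_fusionIdem h.idem hpq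
     bracket := DoubleBracket.isDoubleBracket_fusionBracket h.idem hpq h.bracket
     quasiPoisson :=
      DoubleBracket.isQuasiPoisson_fusionBracket h.idem hpq h.bracket h.quasiPoisson
     momentMap :=
      DoubleBracket.isMomentMap_fusionMomentMap h.idem hpq h.bracket h.momentMap },
    DoubleBracket.finiteType_fusionAlgebra h.idem hpq⟩

theorem mainTheorem2 {k : Type*} [Field k] [CharZero k] {A : Type*} [Ring A] [Algebra k A]
    {I : Type*} [Fintype I] [DecidableEq I] {e : I → A} {br : A →ₗ[k] A →ₗ[k] A ⊗[k] A} {Φ : A}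
    (h : DoubleBracket.IsQuasiHamiltonian e br Φ) {p q : I} (hpq : p ≠ q) :
    DoubleBracket.IsQuasiHamiltonian (DoubleBracket.fusionIdem k h.idem hpq)
        (DoubleBracket.fusionBracket h.idem hpq h.bracket)
        (DoubleBracket.fusionMomentMap k h.idem hpq Φ) ∧
      (Algebra.FiniteType k A →
        Algebra.FiniteType k (DoubleBracket.FusionAlgebra k h.idem hpq)) :=
  mainTheorem2_general h hpq
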